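/- **Setting.** Let $\ell,d\ge 0$ be integers, $T>0$, and let $2<p<\gamma$ be real numbers; $[\cdot]$ denotes the integer part. *Trees.* Let $\mathcal T$ be the set of finite rooted trees (children unordered) with vertices labelled in $\{1,\dots,\ell\}$, and let $[\tau_1\cdots\tau_n]_a$ be the tree obtained by attaching $\tau_1,\dots,\tau_n$ to a new root labelled $a$. A forest $\varphi=\tau_1\cdots\tau_n$ is a commutative monomial in nonempty trees; $\mathbf 1$ is the empty forest, identified with the empty tree; $|\varphi|$ is the number of vertices of $\varphi$. If $\varphi=\tau_1^{n_1}\cdots\tau_k^{n_k}$ with distinct $\tau_i$, its symmetry factor is $\sigma(\varphi)=\sigma([\varphi]_a)=\prod_i n_i!\,\sigma(\tau_i)^{n_i}$. Let $\mathcal F$ be the real polynomial algebra on the nonempty trees, with basis the forests and with the multiplicative Connes–Kreimer coproduct $\Delta\tau=\sum_s(\tau\setminus s)\otimes s$, the sum being over the subtrees $s$ of $\tau$ that are empty or have the same root as $\tau$, where $\tau\setminus s$ is the forest left after removing $s$. For $\mathbf Y,\mathbf X\in\mathcal F^*$ set $\mathbf Y\star\mathbf X=(\mathbf Y\otimes\mathbf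 X)\circ\Delta$, with unit $\mathbf 1^*$, and $\exp_\star(\mathbf a)=\sum_{n\ge0}\mathbf a^{\star n}/n!$ if $\mathbf a(\mathbf 1)=0$. Let $\mathcal G^{N}_\ell$ be the image, under restriction to forests with at most $N$ vertices, of the set of all $\exp_\star(\mathbf a)$ with $\mathbf a=\sum_\tau a^\tau\tau^*$ supported on single nonempty trees; it is a group for $\star$. *Rough paths.* A Hölder branched $p$-rough path on $[0,T]$ is a path $\mathbf X:[0,T]\to\mathcal G^{[p]}_\ell$ such that, with $\mathbf X_{ts}=\mathbf X_s^{-1}\star\mathbf X_t$, one has $\sup_{0\le s<t\le T}|X^\varphi_{ts}|/|t-s|^{|\varphi|/p}<\infty$ for every forest $\varphi$ with $|\varphi|\le[p]$. *Regularity.* A map on $\mathbb R^d$ is of class $C^\gamma$ if it is $[\gamma]$ times continuously differentiable and its derivative of order $[\gamma]$ is $(\gamma-[\gamma])$-Hölder on bounded sets; it is of class $C^\gamma_b$ if moreover it and its derivatives of order at most $[\gamma]$ are bounded and the Hölder condition is global. *Differential operators.* Let $V_1,\dots,V_\ell$ be vector fields on $\mathbb R^d$ of class $C^\gamma$. Define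 $F_{[\tau_1\cdots\tau_n]_a}=(D^nV_a)(F_{\tau_1},\dots,F_{\tau_n})$ for $|[\tau_1\cdots\tau_n]_a|\le[p]$ (so $F_{\bullet_a}=V_a$), and, for a real- or vector-valued $C^\gamma$ function $g$ on $\mathbb R^d$ and $1\le|\tau_1\cdots\tau_n|\le[p]$, $$V\big((\tau_1\cdots\tau_n)^*\big)g=\frac1{\sigma(\tau_1\cdots\tau_n)}\,(D^ng)(F_{\tau_1},\dots,F_{\tau_n}),\qquad V(\mathbf 1^*)g=0,\qquad V(\mathbf X_{ts})g=\sum_{|\varphi|\le[p]}X^\varphi_{ts}\,V(\varphi^*)g .$$ *Solutions.* Let $\mathbf X$ be a Hölder branched $p$-rough path on $[0,T]$. A path $z:[0,T]\to\mathbb R^d$ is a solution of $dz_t=\mathrm F(z_t)\,d\mathbf X_t$, $\mathrm F=(V_1,\dots,V_\ell)$, - *in the sense of Davie* if there are constants $a>1$ and $C$ such that for all $0\le s<t\le T$ $$\big|z_t-z_s-\big(V(\mathbf X_{ts})\mathrm{Id}\big)(z_s)\big|\le C\,|t-s|^a;$$ - *in the sense of Bailleul* if there is a constant $a>1$ such that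 for every real-valued function $f$ on $\mathbb R^d$ of class $C^\gamma$ there is a constant $C_f$ such that for all $0\le s<t\le T$ $$\big|f(z_t)-f(z_s)-\big(V(\mathbf X_{ts})f\big)(z_s)\big|\le C_f\,|t-s|^a.$$ **Theorem 2.** A path $z$ is a solution in the sense of Davie if and only if it is a solution in the sense of Bailleul. The same holds if, in the sense of Bailleul, only the test functions $f$ of class $C^\gamma_b$ are used. -/

import Mathlib

namespace BranchedRP

noncomputable section

/-! ### Labelled rooted trees and forests -/

/-- The functor `X ↦ α × Multiset X`: a root label together with an unordered family of children. -/
def TreeF (α X : Type) : Type := α × Multiset X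

instance (α : Type) : QPF (TreeF α) where
  map f x := (x.1, x.2.map f)
  P := ⟨α × ℕ, fun x => Fin x.2⟩
  abs x := (x.1.1, Finset.univ.val.map x.2)
  repr x := ⟨(x.1, x.2.toList.length), fun i => x.2.toList.get i⟩
  abs_repr x := by
    obtain ⟨a, m⟩ := x
    refine Prod.ext rfl ?_
    simp only [Fin.univ_val_map, List.ofFn_get, Multiset.coe_toList]
  abs_map f x := by
    obtain ⟨n, v⟩ := x
    refine Prod.ext rfl ?_
    change Multiset.map (f ∘ v) (Finset.univ : Finset (Fin n.2)).val =
      Multiset.map f (Multiset.map v (Finset.univ : Finset (Fin n.2)).val)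
    rw [Multiset.map_map]

/-- Nonempty finite rooted trees with vertices labelled by `α`, without any order on the children
of a vertex: the initial algebra of `X ↦ α × Multiset X`. -/
def Tree (α : Type) : Type := QPF.Fix (TreeF α)

/-- Forests: finite families, with repetitions, of nonempty trees, that is, monomials in the trees.
The empty forest `0` is the empty tree `𝟏`, and `+` is the commutative product of forests. -/
abbrev Forest (α : Type) : Type := Multiset (Tree α)

namespace Tree

variable {α β : Type}

instance : DecidableEq (Tree α) := Classical.decEq _

/-- The tree `[τ₁ … τₙ]_a`. -/
def node (a : α) (φ : Forest α) : Tree α := QPF.Fix.mk (F := TreeF α) (a, φ)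

/-- Structural recursion on trees, without access to the subtrees themselves. -/
def fold (g : α → Multiset β → β) : Tree α → β :=
  QPF.Fix.rec (F := TreeF α) fun x => g x.1 x.2

theorem fold_node (g : α → Multiset β → β) (a : α) (φ : Forest α) :
    fold g (node a φ) = g a (φ.map (fold g)) :=
  QPF.Fix.rec_eq (F := TreeF α) _ _

theorem ind {P : Tree α → Prop} (h : ∀ a φ, (∀ τ ∈ φ, P τ) → P (node a φ)) (τ : Tree α) :
    P τ := by
  refine QPF.Fix.ind (F := TreeF α) P ?_ τ
  rintro x ⟨u, rfl⟩
  refine h u.1 (u.2.map Subtype.val) fun τ hτ => ?_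
  obtain ⟨y, _, rfl⟩ := Multiset.mem_map.1 hτ
  exact y.2

theorem node_surj (τ : Tree α) : ∃ a φ, node a φ = τ :=
  ind (P := fun τ => ∃ a φ, node a φ = τ) (fun a φ _ => ⟨a, φ, rfl⟩) τ

theorem node_inj {a b : α} {φ ψ : Forest α} (h : node a φ = node b ψ) : a = b ∧ φ = ψ := by
  have h' : ((a, φ) : TreeF α (QPF.Fix (TreeF α))) = (b, ψ) :=
    ((QPF.Fix.dest_mk (F := TreeF α) (a, φ)).symm.trans
      (congrArg (QPF.Fix.dest (F := TreeF α)) h)).trans (QPF.Fix.dest_mk (F := TreeF α) (b, ψ))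
  exact ⟨congrArg Prod.fst h', congrArg Prod.snd h'⟩

/-- Structural recursion on trees: the value at `[τ₁ … τₙ]_a` is computed from `a` and from the
family of the subtrees `τᵢ`, each together with its value. -/
def para (g : α → Multiset (Tree α × β) → β) (τ : Tree α) : β :=
  (fold (β := Tree α × β) (fun a m => (node a (m.map Prod.fst), g a m)) τ).2

theorem para_node (g : α → Multiset (Tree α × β) → β) (a : α) (φ : Forest α) :
    para g (node a φ) = g a (φ.map fun τ => (τ, para g τ)) := by
  have key : ∀ τ : Tree α,
      (fold (β := Tree α × β) (fun a m => (node a (m.map Prod.fst), g a m)) τ).1 = τ := by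
    refine ind fun a φ hφ => ?_
    rw [fold_node]
    change node a _ = node a φ
    rw [Multiset.map_map]
    congr 1
    conv_rhs => rw [← Multiset.map_id φ]
    exact Multiset.map_congr rfl hφ
  unfold para
  rw [fold_node]
  change g a _ = g a _
  congr 1
  exact Multiset.map_congr rfl fun τ _ => Prod.ext (key τ) rfl

/-- The number `|τ|` of vertices of a tree. -/
def size : Tree α → ℕ := fold fun _ m => 1 + m.sum

end Tree

namespace Forest

variable {α : Type}

/-- The number `|φ|` of vertices of a forest. -/
def size (φ : Forest α) : ℕ := (φ.map Tree.size).sum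

/-- The product of the factorials of the multiplicities of the trees of a forest. -/
def multFactorial (φ : Forest α) : ℕ := ∏ τ ∈ φ.toFinset, (φ.count τ).factorial

end Forest

namespace Tree

variable {α : Type}

theorem size_node (a : α) (φ : Forest α) : size (node a φ) = 1 + Forest.size φ :=
  fold_node _ _ _

/-- The symmetry factor of a tree,
`σ([τ₁^{n₁} … τ_k^{n_k}]_a) = n₁! … n_k! σ(τ₁)^{n₁} … σ(τ_k)^{n_k}` for distinct `τᵢ`. -/
def symm : Tree α → ℕ :=
  para fun _ m => Forest.multFactorial (m.map Prod.fst) * (m.map Prod.snd).prod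

/-- The coproduct `Δτ = ∑ (τ \ s) ⊗ s` of a tree, as the family of the pairs `(τ \ s, s)` where `s`
runs over the subtrees of `τ` that are empty or have the same root as `τ`.  For `τ = [τ₁ … τₙ]_a`
these are the pair `(τ, 𝟏)` and the pairs `(φ₁ ⋯ φₙ, [s₁ … sₙ]_a)`, where each `(φᵢ, sᵢ)` is such a
pair for `τᵢ`.  (`Multiset.Sections` runs over all the choices of one pair for each child.) -/
def coprod : Tree α → Multiset (Forest α × Forest α) :=
  para fun a m =>
    ({node a (m.map Prod.fst)}, 0) ::ₘ
      ((m.map Prod.snd).Sections.map Multiset.sum).map fun x => (x.1, {node a x.2})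

end Tree

namespace Forest

variable {α : Type}

/-- The symmetry factor of a forest, `σ(τ₁ ⋯ τₙ) = σ([τ₁ … τₙ]_a)` for any label `a`. -/
def symm (φ : Forest α) : ℕ := multFactorial φ * (φ.map Tree.symm).prod

/-- The coproduct of a forest, `Δ(τ₁ ⋯ τₙ) = Δ(τ₁) ⋯ Δ(τₙ)`, as a family of pairs of forests. -/
def coprod (φ : Forest α) : Multiset (Forest α × Forest α) :=
  (φ.map Tree.coprod).Sections.map Multiset.sum

end Forest

namespace Tree

variable {α : Type}

theorem symm_node (a : α) (φ : Forest α) : symm (node a φ) = Forest.symm φ := by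
  unfold symm Forest.symm
  rw [para_node, Multiset.map_map, Multiset.map_map]
  simp only [Function.comp_def, Multiset.map_id']
  rfl

theorem coprod_node (a : α) (φ : Forest α) :
    coprod (node a φ) = ({node a φ}, 0) ::ₘ (Forest.coprod φ).map fun x => (x.1, {node a x.2}) := by
  have h1 : (φ.map fun τ => (τ, coprod τ)).map Prod.fst = φ := by
    rw [Multiset.map_map]; exact Multiset.map_id' φ
  have h2 : (φ.map fun τ => (τ, coprod τ)).map Prod.snd = φ.map coprod := by
    rw [Multiset.map_map]; rfl
  refine (para_node _ a φ).trans ?_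
  change ({node a ((φ.map fun τ => (τ, coprod τ)).map Prod.fst)}, 0) ::ₘ
    ((((φ.map fun τ => (τ, coprod τ)).map Prod.snd).Sections.map Multiset.sum).map
      fun x => (x.1, {node a x.2})) = _
  rw [h1, h2]
  rfl

end Tree

namespace Forest

variable {α : Type}

theorem finite_size_le [Finite α] (N : ℕ) : {φ : Forest α | size φ ≤ N}.Finite := by
  have card_le : ∀ φ : Forest α, Multiset.card φ ≤ size φ := by
    intro φ
    unfold size
    have h := Multiset.card_nsmul_le_sum (s := φ.map Tree.size) (a := 1) (by
      intro x hx
      obtain ⟨τ, _, rfl⟩ := Multiset.mem_map.1 hx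
      obtain ⟨a, ψ, rfl⟩ := Tree.node_surj τ
      rw [Tree.size_node]
      omega)
    simpa using h
  have step : ∀ N : ℕ, {τ : Tree α | Tree.size τ ≤ N}.Finite →
      {φ : Forest α | size φ ≤ N}.Finite := by
    intro N hN
    refine (Set.finite_Iic (N • hN.toFinset.val)).subset fun φ hφ => ?_
    refine Multiset.le_iff_count.2 fun τ => ?_
    by_cases hτ : τ ∈ φ
    · have h1 : Tree.size τ ≤ N :=
        (Multiset.le_sum_of_mem (Multiset.mem_map_of_mem Tree.size hτ)).trans hφ
      have h2 : 1 ≤ Multiset.count τ hN.toFinset.val :=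
        Multiset.one_le_count_iff_mem.2 (hN.mem_toFinset.2 h1)
      rw [Multiset.count_nsmul]
      calc Multiset.count τ φ ≤ Multiset.card φ := Multiset.count_le_card _ _
        _ ≤ N * 1 := by simpa using (card_le φ).trans hφ
        _ ≤ N * Multiset.count τ hN.toFinset.val := Nat.mul_le_mul_left _ h2
    · rw [Multiset.count_eq_zero_of_notMem hτ]
      exact Nat.zero_le _
  refine step N ?_
  induction N with
  | zero =>
    refine Set.Finite.subset Set.finite_empty fun τ hτ => ?_
    obtain ⟨a, ψ, rfl⟩ := Tree.node_surj τ
    have h : Tree.size (Tree.node a ψ) ≤ 0 := hτ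
    rw [Tree.size_node] at h
    omega
  | succ N ih =>
    refine ((Set.finite_univ (α := α)).image2 Tree.node (step N ih)).subset fun τ hτ => ?_
    obtain ⟨a, ψ, rfl⟩ := Tree.node_surj τ
    have h : Tree.size (Tree.node a ψ) ≤ N + 1 := hτ
    rw [Tree.size_node] at h
    exact ⟨a, Set.mem_univ _, ψ, by change size ψ ≤ N; omega, rfl⟩

/-- The finite set of the forests with at most `N` vertices. -/
def upTo (α : Type) [Finite α] (N : ℕ) : Finset (Forest α) := (finite_size_le (α := α) N).toFinset

end Forest

/-! ### The dual of the Connes–Kreimer Hopf algebra -/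

/-- The dual of the commutative algebra `𝓕` of real polynomials in the labelled trees: a linear form
is given by its values on the basis of `𝓕` formed by the forests. -/
abbrev Dual (α : Type) : Type := Forest α → ℝ

namespace Dual

variable {α : Type}

/-- The linear form `𝟏*`, dual to the empty tree. -/
def one : Dual α := fun φ => if φ = 0 then 1 else 0

/-- The convolution product `(Y ⋆ X)(φ) = (Y ⊗ X)(Δφ)`. -/
def conv (Y X : Dual α) : Dual α := fun φ => (φ.coprod.map fun x => Y x.1 * X x.2).sum

/-- The powers `Y^{⋆ n}`. -/
def convPow (Y : Dual α) : ℕ → Dual α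
  | 0 => one
  | n + 1 => conv Y (convPow Y n)

/-- The exponential `∑ₙ a^{⋆ n} / n!`, for `a(𝟏) = 0`.  On a forest `φ` the terms with `n > |φ|`
vanish. -/
def convExp (a : Dual α) : Dual α := fun φ =>
  ∑ n ∈ Finset.range (φ.size + 1), convPow a n φ / (n.factorial : ℝ)

/-- The inverse `∑ₙ (𝟏* - Y)^{⋆ n}` of `Y` for `⋆`, when `Y(𝟏) = 1`.  On a forest `φ` the terms with
`n > |φ|` vanish. -/
def convInv (Y : Dual α) : Dual α := fun φ =>
  ∑ n ∈ Finset.range (φ.size + 1), convPow (one - Y) n φ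

/-- The projection `π_{≤ N}`: elements of the truncated dual are represented by the linear forms
that vanish on the forests with more than `N` vertices. -/
def trunc (N : ℕ) (Y : Dual α) : Dual α := fun φ => if φ.size ≤ N then Y φ else 0

/-- The linear forms `∑_τ a^τ τ*` carried by the dual (nonempty) trees. -/
def IsTreeForm (a : Dual α) : Prop := ∀ φ : Forest α, Multiset.card φ ≠ 1 → a φ = 0

/-- The truncated group `𝓖^N = π_{≤ N}(exp_⋆ ⟨𝓣*⟩)`. -/
def truncGroup (α : Type) (N : ℕ) : Set (Dual α) :=
  {Y | ∃ a : Dual α, IsTreeForm a ∧ Y = trunc N (convExp a)}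

/-- The element `Y⁻¹ ⋆ X` of the truncated dual. -/
def increment (N : ℕ) (Y X : Dual α) : Dual α := trunc N (conv (convInv Y) X)

end Dual

/-- A Hölder branched `p`-rough path `X` on `[0,T]`: a path in the group `𝓖^{[p]}` whose increments
`X_{ts} = X_s⁻¹ ⋆ X_t` satisfy `|X_{ts}^φ| ≲ |t - s|^{|φ|/p}` for `|φ| ≤ [p]`. -/
structure IsHolderBranchedRoughPath {ℓ : ℕ} (p T : ℝ) (X : ℝ → Dual (Fin ℓ)) : Prop where
  mem_group : ∀ t, 0 ≤ t → t ≤ T → X t ∈ Dual.truncGroup (Fin ℓ) ⌊p⌋₊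
  bound : ∀ φ : Forest (Fin ℓ), φ.size ≤ ⌊p⌋₊ → ∃ C : ℝ, ∀ s t, 0 ≤ s → s < t → t ≤ T →
    |Dual.increment ⌊p⌋₊ (X s) (X t) φ| ≤ C * (t - s) ^ ((φ.size : ℝ) / p)

/-! ### Differential operators indexed by forests -/

section Operators

variable {α : Type} {d : ℕ} {G : Type*} [NormedAddCommGroup G] [NormedSpace ℝ G]

/-- `(Dⁿg)(W₁, …, Wₙ)` at the point `x`, for a finite family of vector fields `Wᵢ`. -/
def multiDeriv (g : EuclideanSpace ℝ (Fin d) → G)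
    (W : Multiset (EuclideanSpace ℝ (Fin d) → EuclideanSpace ℝ (Fin d)))
    (x : EuclideanSpace ℝ (Fin d)) : G :=
  iteratedFDeriv ℝ W.toList.length g x fun i => W.toList.get i x

/-- The elementary vector fields of the trees, without symmetry factors:
`F(•_a) = V_a` and `F([τ₁ … τₙ]_a) = (DⁿV_a)(F(τ₁), …, F(τₙ))`. -/
def elemField (V : α → EuclideanSpace ℝ (Fin d) → EuclideanSpace ℝ (Fin d)) :
    Tree α → EuclideanSpace ℝ (Fin d) → EuclideanSpace ℝ (Fin d) :=
  Tree.fold fun a W => multiDeriv (V a) W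

/-- The differential operators `V(φ*)`, acting on functions `g` with values in a normed space:
`V(τ₁* ⋯ τₙ*) g = σ(τ₁ ⋯ τₙ)⁻¹ (Dⁿg)(F(τ₁), …, F(τₙ))`, and `V(𝟏*) = 0`.  The vector field
associated with `τ*` is `V(τ*) Id = σ(τ)⁻¹ F(τ)`. -/
def forestOp (V : α → EuclideanSpace ℝ (Fin d) → EuclideanSpace ℝ (Fin d)) (φ : Forest α)
    (g : EuclideanSpace ℝ (Fin d) → G) (x : EuclideanSpace ℝ (Fin d)) : G :=
  if φ = 0 then 0 else (φ.symm : ℝ)⁻¹ • multiDeriv g (φ.map (elemField V)) x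

/-- The differential operator `V(Y) = ∑_{|φ| ≤ N} Y^φ V(φ*)` for `Y` in the truncated dual. -/
def dualOp [Finite α] (N : ℕ) (V : α → EuclideanSpace ℝ (Fin d) → EuclideanSpace ℝ (Fin d))
    (Y : Dual α) (g : EuclideanSpace ℝ (Fin d) → G) (x : EuclideanSpace ℝ (Fin d)) : G :=
  ∑ φ ∈ Forest.upTo α N, Y φ • forestOp V φ g x

/-- `g` is of class `C^γ`: it is `[γ]` times continuously differentiable, and its derivative of order
`[γ]` is `(γ - [γ])`-Hölder on bounded sets. -/
def IsCgamma (γ : ℝ) (g : EuclideanSpace ℝ (Fin d) → G) : Prop :=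
  ContDiff ℝ ((⌊γ⌋₊ : ℕ) : WithTop ℕ∞) g ∧
  ∀ R : ℝ, ∃ C : ℝ, ∀ x y, ‖x‖ ≤ R → ‖y‖ ≤ R →
    ‖iteratedFDeriv ℝ ⌊γ⌋₊ g x - iteratedFDeriv ℝ ⌊γ⌋₊ g y‖ ≤ C * ‖x - y‖ ^ (γ - (⌊γ⌋₊ : ℝ))

/-- `g` is of class `C^γ_b`: it is `[γ]` times continuously differentiable, `g` and its derivatives
of order at most `[γ]` are bounded, and the derivative of order `[γ]` is globally
`(γ - [γ])`-Hölder. -/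
def IsCgammaBounded (γ : ℝ) (g : EuclideanSpace ℝ (Fin d) → G) : Prop :=
  ContDiff ℝ ((⌊γ⌋₊ : ℕ) : WithTop ℕ∞) g ∧
  ∃ C : ℝ, (∀ n ≤ ⌊γ⌋₊, ∀ x, ‖iteratedFDeriv ℝ n g x‖ ≤ C) ∧
    ∀ x y, ‖iteratedFDeriv ℝ ⌊γ⌋₊ g x - iteratedFDeriv ℝ ⌊γ⌋₊ g y‖ ≤
      C * ‖x - y‖ ^ (γ - (⌊γ⌋₊ : ℝ))

end Operators

/-! ### The two notions of solution of `dz = F(z) dX` -/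

section Solutions

variable {ℓ d : ℕ}

/-- `z` is a solution on `[0,T]` in the sense of Davie:
`z_t = z_s + (V(X_{ts}) Id)(z_s) + O(|t - s|^a)` for some `a > 1`. -/
def IsDavieSolution (p T : ℝ) (X : ℝ → Dual (Fin ℓ))
    (V : Fin ℓ → EuclideanSpace ℝ (Fin d) → EuclideanSpace ℝ (Fin d))
    (z : ℝ → EuclideanSpace ℝ (Fin d)) : Prop :=
  ∃ a : ℝ, 1 < a ∧ ∃ C : ℝ, ∀ s t, 0 ≤ s → s < t → t ≤ T →
    ‖z t - (z s + dualOp ⌊p⌋₊ V (Dual.increment ⌊p⌋₊ (X s) (X t)) id (z s))‖ ≤ C * (t - s) ^ a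

/-- `z` is a solution on `[0,T]` in the sense of Bailleul, with respect to a class `𝓒` of test
functions: there is `a > 1` such that `f(z_t) = f(z_s) + (V(X_{ts}) f)(z_s) + O_f(|t - s|^a)` for
every real-valued `f` in `𝓒`. -/
def IsBailleulSolution (p T : ℝ) (X : ℝ → Dual (Fin ℓ))
    (V : Fin ℓ → EuclideanSpace ℝ (Fin d) → EuclideanSpace ℝ (Fin d))
    (𝓒 : (EuclideanSpace ℝ (Fin d) → ℝ) → Prop) (z : ℝ → EuclideanSpace ℝ (Fin d)) : Prop :=
  ∃ a : ℝ, 1 < a ∧ ∀ f, 𝓒 f → ∃ C : ℝ, ∀ s t, 0 ≤ s → s < t → t ≤ T →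
    |f (z t) - (f (z s) + dualOp ⌊p⌋₊ V (Dual.increment ⌊p⌋₊ (X s) (X t)) f (z s))| ≤
      C * (t - s) ^ a

end Solutions

end

end BranchedRP

/-! Write `N = [p]`, let `δ = z_t - z_s`, and let `v` be the Davie increment `(V(X_{ts}) Id)(z_s)`.

From Davie to Bailleul, the idea is to expand a test function `f` around `z_s` to order `N`. The
path is bounded and `δ` is `O(|t-s|^{1/p})`, so Hölder continuity of the last derivative gives a
remainder `O(|t-s|^{(N+β)/p})`, with `β` chosen so that `N + β > p`. Replacing `δ` by `v` in the
Taylor polynomial costs `O(|t-s|^a)`. Since all derivatives of `Id` beyond the first vanish, `v` is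
a combination of the fields `F_τ` of single trees, with coefficients `X^τ_{ts}/σ(τ)`. Expanding `D^k
f(v, …, v)/k!` by multilinearity and grouping equal monomials, the multinomial coefficients and the
`σ(τ)` combine exactly into `1/σ(φ)` (`iteratedFDeriv_sum_smul`). The increment `X_{ts}` is
multiplicative on forests with at most `N` vertices (`isCharUpTo_increment`), so those forests
contribute exactly `f + V(X_{ts}) f` (`add_dualOp`). The other monomials have at least `N + 1`
vertices and are `O(|t-s|^{(N+1)/p})`.

From Bailleul to Davie, bounded test functions are enough. Testing with bump functions around `z_t`
shows that `z` is continuous, hence bounded on `[0,T]`. Coordinates multiplied by a cutoff equal to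
one near the range of `z` are then admissible, and the Bailleul estimates for them are the
coordinates of the Davie estimate. -/

open Filter Topology Asymptotics

namespace BranchedRP

/-! ### Grading and multiplicativity of the coproduct -/

namespace Forest

variable {α : Type}

theorem size_zero : size (0 : Forest α) = 0 := rfl

theorem size_add (φ ψ : Forest α) : size (φ + ψ) = size φ + size ψ := by
  simp [size]

theorem size_cons (τ : Tree α) (φ : Forest α) : size (τ ::ₘ φ) = τ.size + size φ := by
  simp [size]

theorem size_singleton (τ : Tree α) : size {τ} = τ.size := by
  simp [size]

theorem size_pos_of_ne_zero {φ : Forest α} (h : φ ≠ 0) : 0 < size φ := by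
  obtain ⟨τ, hτ⟩ := Multiset.exists_mem_of_ne_zero h
  have h1 : τ.size ≤ size φ := Multiset.le_sum_of_mem (Multiset.mem_map_of_mem Tree.size hτ)
  obtain ⟨a, ψ, rfl⟩ := Tree.node_surj τ
  rw [Tree.size_node] at h1
  omega

theorem card_le_size (φ : Forest α) : Multiset.card φ ≤ size φ := by
  induction φ using Multiset.induction_on with
  | empty => simp
  | cons τ φ ih =>
    obtain ⟨a, ψ, rfl⟩ := Tree.node_surj τ
    rw [size_cons, Multiset.card_cons, Tree.size_node]
    omega

theorem coprod_zero : coprod (0 : Forest α) = {0} := by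
  simp [coprod]

theorem coprod_add (φ ψ : Forest α) :
    coprod (φ + ψ) = (coprod φ ×ˢ coprod ψ).map fun x => x.1 + x.2 := by
  unfold coprod
  rw [Multiset.map_add, Multiset.sections_add]
  simp [SProd.sprod, Multiset.product, Multiset.map_bind, Multiset.bind_map]

theorem coprod_singleton (τ : Tree α) : coprod {τ} = τ.coprod := by
  simp [coprod, ← Multiset.cons_zero, Multiset.sections_cons]

/-- Sums over the coproduct of a product of forests are iterated sums over the two coproducts. -/
theorem sum_coprod_add (φ ψ : Forest α) (f : Forest α × Forest α → ℝ) :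
    ((coprod (φ + ψ)).map f).sum =
      ((coprod φ).map fun x => ((coprod ψ).map fun y => f (x + y)).sum).sum := by
  rw [coprod_add]
  simp [SProd.sprod, Multiset.product, Multiset.map_bind, Multiset.sum_bind]

/-- Induction on forests: products, and grafting onto a new root. -/
theorem ind_add {P : Forest α → Prop} (zero : P 0) (add : ∀ φ ψ, P φ → P ψ → P (φ + ψ))
    (node : ∀ a φ, P φ → P {Tree.node a φ}) (φ : Forest α) : P φ := by
  have all : ∀ φ : Forest α, (∀ τ ∈ φ, P {τ}) → P φ := by
    intro φ
    induction φ using Multiset.induction_on with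
    | empty => exact fun _ => zero
    | cons τ φ ih =>
      intro h
      rw [← Multiset.singleton_add]
      exact add _ _ (h τ (Multiset.mem_cons_self _ _))
        (ih fun σ hσ => h σ (Multiset.mem_cons_of_mem hσ))
  exact all φ fun τ _ => Tree.ind (P := fun τ => P {τ}) (fun a ψ ih => node a ψ (all ψ ih)) τ

theorem size_coprod (φ : Forest α) : ∀ x ∈ coprod φ, size x.1 + size x.2 = size φ := by
  induction φ using ind_add with
  | zero =>
    intro x hx
    rw [coprod_zero, Multiset.mem_singleton] at hx
    subst hx
    rfl
  | add φ ψ h1 h2 =>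
    intro x hx
    rw [coprod_add] at hx
    obtain ⟨⟨y, w⟩, hy, rfl⟩ := Multiset.mem_map.1 hx
    obtain ⟨hy1, hy2⟩ := Multiset.mem_product.1 hy
    have e1 := h1 _ hy1
    have e2 := h2 _ hy2
    simp only [Prod.fst_add, Prod.snd_add, size_add] at *
    omega
  | node a ψ ih =>
    intro x hx
    rw [coprod_singleton, Tree.coprod_node, Multiset.mem_cons] at hx
    rcases hx with rfl | hx
    · simp [size_zero]
    · obtain ⟨y, hy, rfl⟩ := Multiset.mem_map.1 hx
      have := ih y hy
      simp only [size_singleton, Tree.size_node]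
      omega

theorem mem_upTo [Finite α] {N : ℕ} {φ : Forest α} : φ ∈ upTo α N ↔ size φ ≤ N := by
  simp [upTo]

end Forest

/-! ### Characters of the truncated Connes–Kreimer algebra -/

namespace Dual

variable {α : Type}

theorem one_zero : one (0 : Forest α) = 1 := if_pos rfl

theorem one_add (φ ψ : Forest α) : one (φ + ψ) = one φ * one ψ := by
  by_cases h1 : φ = 0 <;> by_cases h2 : ψ = 0 <;> simp [one, h1, h2]

/-- The coproduct contains the term `𝟏 ⊗ φ` exactly once and no other term with empty left factor.
The function `f` stays universally quantified because the product step applies the induction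
hypotheses to translates of `f`. -/
theorem sum_coprod_one_mul (φ : Forest α) : ∀ f : Forest α → ℝ,
    ((Forest.coprod φ).map fun x => one x.1 * f x.2).sum = f φ := by
  induction φ using Forest.ind_add with
  | zero => intro f; simp [Forest.coprod_zero, one]
  | add φ ψ h1 h2 =>
    intro f
    rw [Forest.sum_coprod_add]
    simp only [Prod.fst_add, Prod.snd_add, one_add, mul_assoc, Multiset.sum_map_mul_left]
    rw [h1 fun u => ((Forest.coprod ψ).map fun y => one y.1 * f (u + y.2)).sum,
      h2 fun u => f (φ + u)]
  | node a ψ ih =>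
    intro f
    rw [Forest.coprod_singleton, Tree.coprod_node]
    simp only [Multiset.map_cons, Multiset.sum_cons, Multiset.map_map, Function.comp_def]
    rw [ih fun u => f {Tree.node a u}]
    simp [one]

/-- Multiplicativity on the products of forests with at most `N` vertices. -/
structure IsCharUpTo (N : ℕ) (Y : Dual α) : Prop where
  map_zero : Y 0 = 1
  map_add : ∀ φ ψ, Forest.size φ + Forest.size ψ ≤ N → Y (φ + ψ) = Y φ * Y ψ

theorem conv_zero (Y X : Dual α) : conv Y X 0 = Y 0 * X 0 := by
  simp [conv, Forest.coprod_zero]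

theorem one_conv (Y : Dual α) : conv one Y = Y := funext fun φ => sum_coprod_one_mul φ Y

theorem conv_add (Y X : Dual α) (φ ψ : Forest α) :
    conv Y X (φ + ψ) = ((Forest.coprod φ).map fun x =>
      ((Forest.coprod ψ).map fun y => Y (x.1 + y.1) * X (x.2 + y.2)).sum).sum :=
  Forest.sum_coprod_add φ ψ _

theorem conv_mul_conv (Y X Y' X' : Dual α) (φ ψ : Forest α) :
    conv Y X φ * conv Y' X' ψ = ((Forest.coprod φ).map fun x =>
      ((Forest.coprod ψ).map fun y => Y x.1 * Y' y.1 * (X x.2 * X' y.2)).sum).sum := by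
  unfold conv
  rw [← Multiset.sum_map_mul_right]
  refine congrArg _ (Multiset.map_congr rfl fun x _ => ?_)
  rw [← Multiset.sum_map_mul_left]
  refine congrArg _ (Multiset.map_congr rfl fun y _ => ?_)
  ring

theorem sub_conv (Y X Z : Dual α) : conv (Y - X) Z = conv Y Z - conv X Z := by
  funext φ
  simp [conv, sub_mul, Multiset.sum_map_sub]

theorem sum_map_finset_sum {ι κ : Type*} (m : Multiset ι) (s : Finset κ) (f : ι → κ → ℝ) :
    (m.map fun x => ∑ k ∈ s, f x k).sum = ∑ k ∈ s, (m.map fun x => f x k).sum := by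
  induction m using Multiset.induction_on with
  | empty => simp
  | cons x m ih => simp [ih, Finset.sum_add_distrib]

/-- The coproduct is multiplicative and preserves the total number of vertices, so both factors are
only evaluated within the range where they are multiplicative. -/
theorem IsCharUpTo.conv {N : ℕ} {Y X : Dual α} (hY : IsCharUpTo N Y) (hX : IsCharUpTo N X) :
    IsCharUpTo N (conv Y X) where
  map_zero := by rw [conv_zero, hY.map_zero, hX.map_zero, mul_one]
  map_add φ ψ h := by
    rw [conv_add, conv_mul_conv]
    refine congrArg _ (Multiset.map_congr rfl fun x hx => ?_)
    refine congrArg _ (Multiset.map_congr rfl fun y hy => ?_)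
    have e1 := Forest.size_coprod φ x hx
    have e2 := Forest.size_coprod ψ y hy
    rw [hY.map_add _ _ (by omega), hX.map_add _ _ (by omega)]

theorem IsCharUpTo.trunc {N : ℕ} {Y : Dual α} (hY : IsCharUpTo N Y) :
    IsCharUpTo N (trunc N Y) where
  map_zero := by simp [Dual.trunc, Forest.size_zero, hY.map_zero]
  map_add φ ψ h := by
    have h1 : Forest.size φ ≤ N := by omega
    have h2 : Forest.size ψ ≤ N := by omega
    simp [Dual.trunc, Forest.size_add, h, h1, h2, hY.map_add φ ψ h]

theorem IsCharUpTo.apply_eq_prod {N : ℕ} {Y : Dual α} (hY : IsCharUpTo N Y) (φ : Forest α)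
    (hφ : φ.size ≤ N) : Y φ = (φ.map fun τ => Y {τ}).prod := by
  induction φ using Multiset.induction_on with
  | empty => simpa using hY.map_zero
  | cons τ φ ih =>
    rw [Forest.size_cons] at hφ
    rw [← Multiset.singleton_add, hY.map_add _ _ (by rw [Forest.size_singleton]; omega),
      ih (by omega)]
    simp

/-- Each factor `a` must receive at least one vertex, so `n` factors need `n` vertices. -/
theorem convPow_eq_zero {a : Dual α} (ha : a 0 = 0) (n : ℕ) (φ : Forest α) (h : φ.size < n) :
    convPow a n φ = 0 := by
  induction n generalizing φ with
  | zero => omega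
  | succ n ih =>
    refine Multiset.sum_eq_zero fun r hr => ?_
    obtain ⟨x, hx, rfl⟩ := Multiset.mem_map.1 hr
    have e := Forest.size_coprod φ x hx
    by_cases h1 : x.1 = 0
    · rw [h1, ha, zero_mul]
    · have := Forest.size_pos_of_ne_zero h1
      rw [ih x.2 (by omega), mul_zero]

/-- A product of two nonempty forests is never a single tree; hence `a` is an infinitesimal
character. -/
theorem IsTreeForm.apply_add {a : Dual α} (ha : IsTreeForm a) (φ ψ : Forest α) :
    a (φ + ψ) = a φ * one ψ + one φ * a ψ := by
  have h0 : a 0 = 0 := ha 0 (by simp)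
  by_cases h1 : φ = 0
  · by_cases h2 : ψ = 0 <;> simp [one, h1, h2, h0]
  · by_cases h2 : ψ = 0
    · simp [one, h1, h2]
    · have c1 := Multiset.card_pos.2 h1
      have c2 := Multiset.card_pos.2 h2
      rw [ha _ (by rw [Multiset.card_add]; omega)]
      simp [one, h1, h2]

/-- Leibniz's rule: `a` acts as a derivation on products, and iterating it produces binomial
coefficients. -/
theorem IsTreeForm.convPow_add {a : Dual α} (ha : IsTreeForm a) (n : ℕ) (φ ψ : Forest α) :
    convPow a n (φ + ψ) = ∑ k ∈ Finset.HasAntidiagonal.antidiagonal n,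
      (n.choose k.1 : ℝ) * (convPow a k.1 φ * convPow a k.2 ψ) := by
  induction n generalizing φ ψ with
  | zero => simp [convPow, one_add]
  | succ n ih =>
    -- Inserting the unit `one` as a convolution factor puts both kinds of terms in the form of
    -- double sums over the coproducts of `φ` and `ψ`, comparable term by term.
    have e1 : ∀ k : ℕ × ℕ, convPow a (k.1 + 1) φ * convPow a k.2 ψ =
        conv a (convPow a k.1) φ * conv one (convPow a k.2) ψ := fun k => by
      rw [one_conv]; rfl
    have e2 : ∀ k : ℕ × ℕ, convPow a k.1 φ * convPow a (k.2 + 1) ψ =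
        conv one (convPow a k.1) φ * conv a (convPow a k.2) ψ := fun k => by
      rw [one_conv]; rfl
    have h1 : convPow a (n + 1) (φ + ψ) = ∑ k ∈ Finset.HasAntidiagonal.antidiagonal n,
        (n.choose k.1 : ℝ) * (convPow a (k.1 + 1) φ * convPow a k.2 ψ +
          convPow a k.1 φ * convPow a (k.2 + 1) ψ) := by
      simp only [e1, e2, conv_mul_conv, ← Multiset.sum_map_add, ← Multiset.sum_map_mul_left,
        ← sum_map_finset_sum]
      change conv a (convPow a n) (φ + ψ) = _
      rw [conv_add]
      refine congrArg _ (Multiset.map_congr rfl fun x _ => ?_)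
      refine congrArg _ (Multiset.map_congr rfl fun y _ => ?_)
      rw [ih, ha.apply_add, Finset.mul_sum]
      refine Finset.sum_congr rfl fun k _ => ?_
      ring
    rw [h1, Finset.sum_antidiagonal_choose_succ_mul
      (fun i j => convPow a i φ * convPow a j ψ) n]
    simp only [mul_add, Finset.sum_add_distrib]
    rw [add_comm]
    congr 1
    refine Finset.sum_congr rfl fun k hk => ?_
    rw [Nat.choose_symm_of_eq_add (Finset.HasAntidiagonal.mem_antidiagonal.1 hk).symm]

theorem IsTreeForm.isCharUpTo_convExp {a : Dual α} (ha : IsTreeForm a) (N : ℕ) :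
    IsCharUpTo N (convExp a) where
  map_zero := by simp [convExp, Forest.size_zero, convPow, one]
  map_add φ ψ _ := by
    have h0 : a 0 = 0 := ha 0 (by simp)
    unfold convExp
    rw [Finset.sum_mul_sum, ← Finset.sum_product',
      ← Finset.sum_fiberwise_of_maps_to (g := fun k : ℕ × ℕ => k.1 + k.2)
        (t := Finset.range ((φ + ψ).size + 1))]
    · refine Finset.sum_congr rfl fun n _ => ?_
      rw [ha.convPow_add, Finset.sum_div]
      symm
      -- The antidiagonal may leave the rectangle given by the two truncated series; there one of
      -- the two powers vanishes.
      refine (Finset.sum_subset (s₂ := Finset.HasAntidiagonal.antidiagonal n)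
        (fun k hk => ?_) fun k hk hk' => ?_).trans (Finset.sum_congr rfl fun k hk => ?_)
      · exact Finset.HasAntidiagonal.mem_antidiagonal.2 (Finset.mem_filter.1 hk).2
      · rw [Finset.HasAntidiagonal.mem_antidiagonal] at hk
        simp only [Finset.mem_filter, Finset.mem_product, Finset.mem_range, hk, and_true,
          not_and_or, not_lt] at hk'
        rcases hk' with h | h
        · rw [convPow_eq_zero h0 k.1 φ (by omega), zero_div, zero_mul]
        · rw [convPow_eq_zero h0 k.2 ψ (by omega), zero_div, mul_zero]
      · rw [Finset.HasAntidiagonal.mem_antidiagonal] at hk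
        have h := Nat.add_choose_mul_factorial_mul_factorial k.1 k.2
        rw [hk] at h
        rw [← Nat.choose_symm_of_eq_add hk.symm] at h
        have h' : (n.choose k.1 : ℝ) * (k.1.factorial : ℝ) * (k.2.factorial : ℝ) =
            (n.factorial : ℝ) := by exact_mod_cast h
        have p1 : (k.1.factorial : ℝ) ≠ 0 := by positivity
        have p2 : (k.2.factorial : ℝ) ≠ 0 := by positivity
        have p3 : (n.factorial : ℝ) ≠ 0 := by positivity
        field_simp
        rw [← h']
        ring
    · intro k hk
      simp only [Finset.mem_product, Finset.mem_range] at hk ⊢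
      rw [Forest.size_add]
      omega

/-- Neumann series: writing `Y = one - (one - Y)`, the sum telescopes and its last term vanishes for
lack of vertices. -/
theorem conv_convInv {Y : Dual α} (hY : Y 0 = 1) : conv Y (convInv Y) = one := by
  have h0 : (one - Y : Dual α) 0 = 0 := by simp [one, hY]
  have key : ∀ φ, conv (one - Y) (convInv Y) φ =
      ∑ n ∈ Finset.range (φ.size + 1), convPow (one - Y) (n + 1) φ := by
    intro φ
    change _ = ∑ n ∈ Finset.range (φ.size + 1), conv (one - Y) (convPow (one - Y) n) φ
    unfold conv
    rw [← sum_map_finset_sum]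
    refine congrArg _ (Multiset.map_congr rfl fun x hx => ?_)
    rw [← Finset.mul_sum]
    congr 1
    have e := Forest.size_coprod φ x hx
    refine Finset.sum_subset (Finset.range_subset_range.2 (by omega)) fun n _ hn => ?_
    exact convPow_eq_zero h0 n _ (by simpa using hn)
  funext φ
  have h1 : conv Y (convInv Y) φ = convInv Y φ - conv (one - Y) (convInv Y) φ := by
    rw [sub_conv, one_conv, Pi.sub_apply]
    ring
  rw [h1, key]
  unfold convInv
  rw [← Finset.sum_sub_distrib, Finset.sum_range_sub' (fun n => convPow (one - Y) n φ),
    convPow_eq_zero h0 (φ.size + 1) φ (by omega), sub_zero]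
  rfl

theorem IsCharUpTo.convInv {N : ℕ} {Y : Dual α} (hY : IsCharUpTo N Y) :
    IsCharUpTo N (convInv Y) where
  map_zero := by simp [Dual.convInv, Forest.size_zero, convPow, one]
  map_add φ ψ h := by
    induction hn : Forest.size φ + Forest.size ψ using Nat.strong_induction_on
      generalizing φ ψ with
    | _ n ih =>
      have hc := conv_convInv hY.map_zero
      set Z := Dual.convInv Y
      -- The first factor vanishes when both left parts are empty. Otherwise the right parts have
      -- fewer vertices in total and the second factor vanishes by induction. Expanding this zero
      -- with `Y ⋆ Z = one` leaves the multiplicativity of `Z` at `φ`, `ψ`.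
      have hz : ((Forest.coprod φ).map fun x => ((Forest.coprod ψ).map fun y =>
          (Y x.1 * Y y.1 - one x.1 * one y.1) *
            (Z (x.2 + y.2) - Z x.2 * Z y.2)).sum).sum = 0 := by
        refine Multiset.sum_eq_zero fun r hr => ?_
        obtain ⟨x, hx, rfl⟩ := Multiset.mem_map.1 hr
        refine Multiset.sum_eq_zero fun r hr => ?_
        obtain ⟨y, hy, rfl⟩ := Multiset.mem_map.1 hr
        have e1 := Forest.size_coprod φ x hx
        have e2 := Forest.size_coprod ψ y hy
        by_cases h0 : x.1 = 0 ∧ y.1 = 0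
        · rw [h0.1, h0.2, hY.map_zero, one_zero, sub_self, zero_mul]
        · have : 0 < Forest.size x.1 + Forest.size y.1 := by
            rcases not_and_or.1 h0 with h0 | h0 <;>
              have := Forest.size_pos_of_ne_zero h0 <;> omega
          rw [ih _ (by omega) x.2 y.2 (by omega) rfl, sub_self, mul_zero]
      have e1 : ((Forest.coprod φ).map fun x => ((Forest.coprod ψ).map fun y =>
          Y x.1 * Y y.1 * Z (x.2 + y.2)).sum).sum = Dual.conv Y Z (φ + ψ) := by
        rw [conv_add]
        refine congrArg _ (Multiset.map_congr rfl fun x hx => ?_)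
        refine congrArg _ (Multiset.map_congr rfl fun y hy => ?_)
        have e1 := Forest.size_coprod φ x hx
        have e2 := Forest.size_coprod ψ y hy
        rw [hY.map_add _ _ (by omega)]
      have e2 : ((Forest.coprod φ).map fun x => ((Forest.coprod ψ).map fun y =>
          one x.1 * one y.1 * Z (x.2 + y.2)).sum).sum = Dual.conv one Z (φ + ψ) := by
        rw [conv_add]
        simp only [one_add]
      simp only [sub_mul, mul_sub, Multiset.sum_map_sub, ← conv_mul_conv] at hz
      simp only [e1, e2, hc, one_conv, one_add] at hz
      linarith

theorem isCharUpTo_increment {N : ℕ} {Y X : Dual α} (hY : Y ∈ truncGroup α N)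
    (hX : X ∈ truncGroup α N) : IsCharUpTo N (increment N Y X) := by
  obtain ⟨a, ha, rfl⟩ := hY
  obtain ⟨b, hb, rfl⟩ := hX
  exact ((ha.isCharUpTo_convExp N).trunc.convInv.conv
    (hb.isCharUpTo_convExp N).trunc).trunc

end Dual

/-! ### Grouping tuples into multisets -/

section Multinomial

variable {ι : Type*} [DecidableEq ι]

theorem prod_count_factorial_mul_countPerms (m : Multiset ι) :
    (∏ i ∈ m.toFinset, (m.count i).factorial) * m.countPerms = (Multiset.card m).factorial := by
  have h := Nat.multinomial_spec m.toFinset fun i => m.count i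
  rw [Multiset.toFinset_sum_count_eq] at h
  rw [← h]
  rfl

/-- This is the multinomial theorem in the monoid algebra of multisets, the universal case:
comparing two expansions of the `k`-th power of a sum of generators and applying the linear map `m ↦
H m` gives any `H`. -/
theorem sum_piFinset_eq_sum_sym {M : Type*} [AddCommGroup M] [Module ℝ M] (S : Finset ι) (k : ℕ)
    (H : Multiset ι → M) :
    ∑ q ∈ Fintype.piFinset fun _ : Fin k => S, H (Finset.univ.val.map q) =
      ∑ m ∈ S.sym k, ((m : Multiset ι).countPerms : ℝ) • H m := by
  let X : ι → AddMonoidAlgebra ℝ (Multiset ι) := fun i => AddMonoidAlgebra.single {i} 1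
  let L : AddMonoidAlgebra ℝ (Multiset ι) →ₗ[ℝ] M :=
    Finsupp.linearCombination ℝ H ∘ₗ (AddMonoidAlgebra.coeffLinearEquiv ℝ).toLinearMap
  have hL : ∀ (m : Multiset ι) (r : ℝ), L (AddMonoidAlgebra.single m r) = r • H m := by
    intro m r
    simp [L]
  have hX : ∀ m : Multiset ι, (m.map X).prod = AddMonoidAlgebra.single m 1 := by
    intro m
    induction m using Multiset.induction_on with
    | empty => simp [AddMonoidAlgebra.one_def]
    | cons i m ih => simp [ih, X, AddMonoidAlgebra.single_mul_single]
  have h := congrArg L ((Finset.sum_pow' S X k).symm.trans (Finset.sum_pow X k))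
  rw [map_sum, map_sum] at h
  convert h using 1
  · refine Finset.sum_congr rfl fun q _ => ?_
    have e : ∏ i, X (q i) = ((Finset.univ.val.map q).map X).prod := by
      rw [Multiset.map_map]; rfl
    rw [e, hX, hL, one_smul]
  · refine Finset.sum_congr rfl fun m _ => ?_
    rw [hX, ← nsmul_eq_mul, map_nsmul, hL, one_smul, Nat.cast_smul_eq_nsmul]
    rfl

end Multinomial

/-! ### Symmetry of higher derivatives -/

section Derivatives

variable {E : Type*} [NormedAddCommGroup E] [NormedSpace ℝ E]
  {G : Type*} [NormedAddCommGroup G] [NormedSpace ℝ G]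

theorem contDiff_iteratedFDeriv_apply {g : E → G} {m n k : ℕ} (hg : ContDiff ℝ k g) (h : m + n ≤ k)
    (v : Fin n → E) : ContDiff ℝ m fun y => iteratedFDeriv ℝ n g y v := by
  have h1 : ContDiff ℝ m (iteratedFDeriv ℝ n g) := hg.iteratedFDeriv_right (by exact_mod_cast h)
  exact (ContinuousMultilinearMap.apply ℝ (fun _ : Fin n => E) G v).contDiff.comp h1

theorem iteratedFDeriv_cons_get {g : E → G} {k : ℕ} {l : List E} (hg : ContDiff ℝ k g)
    (h : l.length < k) (x a : E) :
    iteratedFDeriv ℝ (a :: l).length g x (a :: l).get =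
      fderiv ℝ (fun y => iteratedFDeriv ℝ l.length g y l.get) x a := by
  rw [fderiv_continuousMultilinear_apply_const_apply
    (hg.differentiable_iteratedFDeriv (by exact_mod_cast h) x)]
  rfl

/-- Adjacent transpositions suffice, and each reduces to the symmetry of a second derivative. This
makes `multiDeriv` independent of the arbitrary order chosen by `toList`. -/
theorem iteratedFDeriv_get_of_perm {g : E → G} {k : ℕ} (hg : ContDiff ℝ k g) {l l' : List E}
    (hp : l.Perm l') (h : l.length ≤ k) (x : E) :
    iteratedFDeriv ℝ l.length g x l.get = iteratedFDeriv ℝ l'.length g x l'.get := by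
  induction hp generalizing x with
  | nil => rfl
  | @cons a l l' hp ih =>
    rw [List.length_cons] at h
    rw [iteratedFDeriv_cons_get hg (by omega), iteratedFDeriv_cons_get hg (hp.length_eq ▸ h)]
    congr 2
    exact funext fun y => ih (by omega) y
  | swap a b l =>
    simp only [List.length_cons] at h
    have key : ∀ a b : E, iteratedFDeriv ℝ (a :: b :: l).length g x (a :: b :: l).get =
        fderiv ℝ (fderiv ℝ fun y => iteratedFDeriv ℝ l.length g y l.get) x a b := by
      intro a b
      have h2 : ContDiff ℝ 2 fun y => iteratedFDeriv ℝ l.length g y l.get :=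
        contDiff_iteratedFDeriv_apply (m := 2) hg (by omega) _
      rw [iteratedFDeriv_cons_get hg (by rw [List.length_cons]; omega)]
      simp only [iteratedFDeriv_cons_get hg (show l.length < k by omega)]
      rw [fderiv_clm_apply ((h2.fderiv_right (m := 1) le_rfl).differentiable one_ne_zero x)
        (differentiableAt_const b)]
      simp
    rw [key, key]
    exact ((contDiff_iteratedFDeriv_apply (m := 2) hg (by omega) _).contDiffAt.isSymmSndFDerivAt
      (by simp)) _ _
  | trans h1 _ ih1 ih2 => rw [ih1 h, ih2 (h1.length_eq ▸ h)]

theorem iteratedFDeriv_eq_get (g : E → G) (x : E) {l : List E} {n : ℕ} (h : l.length = n)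
    (v : Fin n → E) (hv : ∀ i, v i = l.get (i.cast h.symm)) :
    iteratedFDeriv ℝ n g x v = iteratedFDeriv ℝ l.length g x l.get := by
  subst h
  exact congrArg _ (funext hv)

end Derivatives

/-! ### Continuity of the elementary differentials -/

section Operators

variable {d : ℕ} {G : Type*} [NormedAddCommGroup G] [NormedSpace ℝ G]

theorem multiDeriv_map_univ {g : EuclideanSpace ℝ (Fin d) → G} {n : ℕ} (hg : ContDiff ℝ n g)
    (v : Fin n → EuclideanSpace ℝ (Fin d) → EuclideanSpace ℝ (Fin d))
    (x : EuclideanSpace ℝ (Fin d)) :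
    multiDeriv g (Finset.univ.val.map v) x = iteratedFDeriv ℝ n g x fun i => v i x := by
  set W := (Finset.univ.val.map v).toList with hW
  have hp : W.Perm (List.ofFn v) := by
    rw [← Multiset.coe_eq_coe, hW, Multiset.coe_toList, Fin.univ_val_map]
  have hp' : (W.map fun w => w x).Perm ((List.ofFn v).map fun w => w x) := hp.map _
  have hl : W.length = n := by rw [hp.length_eq, List.length_ofFn]
  unfold multiDeriv
  rw [iteratedFDeriv_eq_get g x (l := W.map fun w => w x) (List.length_map _) _
      fun i => by simp only [List.get_eq_getElem, List.getElem_map]; rfl,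
    iteratedFDeriv_get_of_perm hg hp' (by simp [hl]),
    ← iteratedFDeriv_eq_get g x (n := n) (by simp) (fun i => v i x) fun i => by simp]

theorem continuous_multiDeriv {g : EuclideanSpace ℝ (Fin d) → G} {k : ℕ} (hg : ContDiff ℝ k g)
    {W : Multiset (EuclideanSpace ℝ (Fin d) → EuclideanSpace ℝ (Fin d))}
    (hW : Multiset.card W ≤ k) (hc : ∀ w ∈ W, Continuous w) : Continuous (multiDeriv g W) := by
  have h1 : Continuous (iteratedFDeriv ℝ W.toList.length g) :=
    hg.continuous_iteratedFDeriv (by simpa using hW)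
  have h2 : Continuous fun x => fun i : Fin W.toList.length => W.toList.get i x :=
    continuous_pi fun i => hc _ (Multiset.mem_toList.1 (List.get_mem W.toList i))
  unfold multiDeriv
  exact h1.eval h2

variable {α : Type}

theorem continuous_elemField {V : α → EuclideanSpace ℝ (Fin d) → EuclideanSpace ℝ (Fin d)} {k : ℕ}
    (hV : ∀ i, ContDiff ℝ k (V i)) (τ : Tree α) (h : τ.size ≤ k + 1) :
    Continuous (elemField V τ) := by
  induction τ using Tree.ind with
  | h a φ ih =>
    rw [Tree.size_node] at h
    unfold elemField
    rw [Tree.fold_node]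
    refine continuous_multiDeriv (hV a) ?_ fun w hw => ?_
    · rw [Multiset.card_map]
      exact (Forest.card_le_size φ).trans (by omega)
    · obtain ⟨τ, hτ, rfl⟩ := Multiset.mem_map.1 hw
      have : τ.size ≤ Forest.size φ := Multiset.le_sum_of_mem (Multiset.mem_map_of_mem Tree.size hτ)
      exact ih τ hτ (by omega)

theorem continuous_forestOp {V : α → EuclideanSpace ℝ (Fin d) → EuclideanSpace ℝ (Fin d)} {k : ℕ}
    (hV : ∀ i, ContDiff ℝ k (V i)) {g : EuclideanSpace ℝ (Fin d) → G} (hg : ContDiff ℝ k g)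
    (φ : Forest α) (h : φ.size ≤ k) : Continuous (forestOp V φ g) := by
  unfold forestOp
  split_ifs with h0
  · exact continuous_const
  · refine (continuous_multiDeriv hg ?_ fun w hw => ?_).const_smul _
    · rw [Multiset.card_map]
      exact (Forest.card_le_size φ).trans h
    · obtain ⟨τ, hτ, rfl⟩ := Multiset.mem_map.1 hw
      have : τ.size ≤ Forest.size φ := Multiset.le_sum_of_mem (Multiset.mem_map_of_mem Tree.size hτ)
      exact continuous_elemField hV τ (by omega)

end Operators

/-! ### Taylor's formula with Hölder remainder -/

section Taylor

variable {E : Type*} [NormedAddCommGroup E] [NormedSpace ℝ E]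

theorem iteratedDeriv_comp_line {f : E → ℝ} {k : ℕ} (hf : ContDiff ℝ k f) (x w : E) (u : ℝ) :
    iteratedDeriv k (fun u : ℝ => f (x + u • w)) u =
      iteratedFDeriv ℝ k f (x + u • w) fun _ => w := by
  induction k generalizing u with
  | zero => simp
  | succ k ih =>
    have hd : DifferentiableAt ℝ (iteratedFDeriv ℝ k f) (x + u • w) :=
      hf.differentiable_iteratedFDeriv (by exact_mod_cast k.lt_succ_self) _
    rw [iteratedDeriv_succ,
      funext fun u => ih (hf.of_le (by exact_mod_cast k.le_succ)) u]
    have h1 : HasDerivAt (fun u : ℝ => x + u • w) w u := by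
      simpa using ((hasDerivAt_id u).smul_const w).const_add x
    have h2 := (hd.hasFDerivAt.comp_hasDerivAt u h1)
    have h3 := ((ContinuousMultilinearMap.apply ℝ (fun _ : Fin k => E) ℝ
      fun _ => w).hasFDerivAt.comp_hasDerivAt u h2).deriv
    exact h3

/-- Taylor's formula, with the increment of the last derivative as remainder. -/
theorem abs_sub_taylor_le {f : E → ℝ} {n : ℕ} (hf : ContDiff ℝ (n + 1 : ℕ) f) (x w : E) {K : ℝ}
    (hK : ∀ u ∈ Set.Icc (0 : ℝ) 1,
      ‖iteratedFDeriv ℝ (n + 1) f (x + u • w) - iteratedFDeriv ℝ (n + 1) f x‖ ≤ K) :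
    |f (x + w) - ∑ k ∈ Finset.range (n + 1 + 1),
      (k.factorial : ℝ)⁻¹ * iteratedFDeriv ℝ k f x fun _ => w| ≤ K * ‖w‖ ^ (n + 1) := by
  have hh : ContDiff ℝ (n + 1 : ℕ) fun u : ℝ => f (x + u • w) := hf.comp (by fun_prop)
  obtain ⟨u, hu, h⟩ := taylor_mean_remainder_lagrange_iteratedDeriv (zero_ne_one (α := ℝ))
    (f := fun u : ℝ => f (x + u • w)) (n := n) (by exact_mod_cast hh.contDiffOn)
  rw [Set.uIoo_of_le zero_le_one] at hu
  rw [iteratedDeriv_comp_line hf, taylor_within_apply] at h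
  have hT : ∀ k ∈ Finset.range (n + 1), (((k.factorial : ℝ)⁻¹ * (1 - 0) ^ k) •
      iteratedDerivWithin k (fun u : ℝ => f (x + u • w)) (Set.uIcc 0 1) 0) =
      (k.factorial : ℝ)⁻¹ * iteratedFDeriv ℝ k f x fun _ => w := by
    intro k hk
    have hk' : k ≤ n + 1 := (Finset.mem_range.1 hk).le
    rw [iteratedDerivWithin_eq_iteratedDeriv (uniqueDiffOn_uIcc zero_ne_one)
      (hh.of_le (by exact_mod_cast hk')).contDiffAt Set.left_mem_uIcc,
      iteratedDeriv_comp_line (hf.of_le (by exact_mod_cast hk'))]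
    simp
  rw [Finset.sum_congr rfl hT] at h
  rw [Finset.sum_range_succ]
  -- Subtracting the term of order `n + 1` from the Lagrange remainder leaves an increment of the
  -- top derivative, so no further derivative is needed.
  have e : f (x + w) - (∑ k ∈ Finset.range (n + 1), (k.factorial : ℝ)⁻¹ *
        (iteratedFDeriv ℝ k f x fun _ => w) + ((n + 1).factorial : ℝ)⁻¹ *
        iteratedFDeriv ℝ (n + 1) f x fun _ => w) = ((n + 1).factorial : ℝ)⁻¹ *
      (iteratedFDeriv ℝ (n + 1) f (x + u • w) - iteratedFDeriv ℝ (n + 1) f x) fun _ => w := by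
    simp only [one_smul, sub_zero, one_pow, mul_one] at h
    rw [← sub_sub, h]
    simp only [sub_apply]
    ring
  rw [e, abs_mul]
  have h1 : |((n + 1).factorial : ℝ)⁻¹| ≤ 1 := by
    rw [abs_of_nonneg (by positivity)]
    exact inv_le_one_of_one_le₀ (by exact_mod_cast (n + 1).factorial_pos)
  refine (mul_le_of_le_one_left (abs_nonneg _) h1).trans ?_
  refine (ContinuousMultilinearMap.le_opNorm (iteratedFDeriv ℝ (n + 1) f (x + u • w) -
    iteratedFDeriv ℝ (n + 1) f x) fun _ => w).trans ?_
  rw [Finset.prod_const, Finset.card_univ, Fintype.card_fin]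
  exact mul_le_mul_of_nonneg_right (hK u ⟨hu.1.le, hu.2.le⟩) (by positivity)

end Taylor

/-! ### Hölder regularity of test functions -/

section Regularity

variable {d : ℕ} {G : Type*} [NormedAddCommGroup G] [NormedSpace ℝ G]

/-- If `[γ] = [p]`, take `β = γ - [p]`; otherwise the derivative of order `[p]` is `C^1`, hence
locally Lipschitz, and `β = 1`. The exponent precedes `g` because the Bailleul exponent must not
depend on the test function. -/
theorem exists_holder_exponent {p γ : ℝ} (hp : 0 ≤ p) (hγ : p < γ) :
    ∃ β : ℝ, 0 < β ∧ β ≤ 1 ∧ p < ⌊p⌋₊ + β ∧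
      ∀ g : EuclideanSpace ℝ (Fin d) → G, IsCgamma γ g → ContDiff ℝ (⌊p⌋₊ : ℕ) g ∧
        ∀ R : ℝ, ∃ C : ℝ, 0 ≤ C ∧ ∀ x y, ‖x‖ ≤ R → ‖y‖ ≤ R →
          ‖iteratedFDeriv ℝ ⌊p⌋₊ g x - iteratedFDeriv ℝ ⌊p⌋₊ g y‖ ≤ C * ‖x - y‖ ^ β := by
  have hN := Nat.floor_le hp
  have hle : ⌊p⌋₊ ≤ ⌊γ⌋₊ := Nat.floor_mono hγ.le
  rcases hle.eq_or_lt with h | h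
  · refine ⟨γ - ⌊p⌋₊, by linarith, ?_, by linarith, fun g hg => ⟨h ▸ hg.1, fun R => ?_⟩⟩
    · rw [h]
      linarith [Nat.lt_floor_add_one γ]
    · obtain ⟨C, hC⟩ := hg.2 R
      refine ⟨|C|, abs_nonneg C, fun x y hx hy => ?_⟩
      rw [h]
      exact (hC x y hx hy).trans (mul_le_mul_of_nonneg_right (le_abs_self C) (by positivity))
  · refine ⟨1, one_pos, le_rfl, Nat.lt_floor_add_one p, fun g hg =>
      ⟨hg.1.of_le (by exact_mod_cast hle), fun R => ?_⟩⟩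
    have h1 : ContDiff ℝ 1 (iteratedFDeriv ℝ ⌊p⌋₊ g) :=
      hg.1.iteratedFDeriv_right (by rw [add_comm]; exact_mod_cast h)
    obtain ⟨C, hC⟩ :=
      (isCompact_closedBall (0 : EuclideanSpace ℝ (Fin d)) R).exists_bound_of_continuousOn
      (h1.continuous_fderiv one_ne_zero).continuousOn
    refine ⟨|C|, abs_nonneg C, fun x y hx hy => ?_⟩
    rw [Real.rpow_one]
    refine (convex_closedBall (0 : EuclideanSpace ℝ (Fin d)) R).norm_image_sub_le_of_norm_fderiv_le
      (𝕜 := ℝ) (fun u _ => h1.differentiable one_ne_zero u)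
      (fun u hu => (hC u hu).trans (le_abs_self C)) ?_ ?_ <;> simpa

theorem IsCgammaBounded.isCgamma {γ : ℝ} {g : EuclideanSpace ℝ (Fin d) → G}
    (hg : IsCgammaBounded γ g) : IsCgamma γ g := by
  obtain ⟨h, C, _, hC⟩ := hg
  exact ⟨h, fun R => ⟨C, fun x y _ _ => hC x y⟩⟩

theorem isCgammaBounded_of_hasCompactSupport {γ : ℝ} (hγ : 0 ≤ γ)
    {g : EuclideanSpace ℝ (Fin d) → G} (hg : ContDiff ℝ (⊤ : ℕ∞) g) (hc : HasCompactSupport g) :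
    IsCgammaBounded γ g := by
  have hb : ∀ n : ℕ, ∃ C, ∀ x, ‖iteratedFDeriv ℝ n g x‖ ≤ C := fun n =>
    (hc.iteratedFDeriv n).exists_bound_of_continuous
      (hg.continuous_iteratedFDeriv (by exact_mod_cast le_top))
  choose B hB using hb
  have hB0 : ∀ n, 0 ≤ B n := fun n => (norm_nonneg _).trans (hB n 0)
  have hN := Nat.floor_le hγ
  have hN' := Nat.lt_floor_add_one γ
  set N := ⌊γ⌋₊
  -- This constant dominates the sup bounds, the Lipschitz constant `B (N + 1)` used at distance at
  -- most one, and the bound `2 * B N` used at larger distance.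
  refine ⟨hg.of_le (by exact_mod_cast le_top), 2 * ∑ n ∈ Finset.range (N + 2), B n, ?_, ?_⟩
  · intro n hn x
    have h1 : B n ≤ ∑ n ∈ Finset.range (N + 2), B n :=
      Finset.single_le_sum (fun n _ => hB0 n) (Finset.mem_range.2 (by omega))
    linarith [hB n x, hB0 n]
  · intro x y
    have h1 : B N + B (N + 1) ≤ ∑ n ∈ Finset.range (N + 2), B n := by
      rw [Finset.sum_range_succ, Finset.sum_range_succ]
      linarith [Finset.sum_nonneg fun n (_ : n ∈ Finset.range N) => hB0 n]
    have e1 : ‖iteratedFDeriv ℝ N g x - iteratedFDeriv ℝ N g y‖ ≤ 2 * B N :=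
      (norm_sub_le _ _).trans (by linarith [hB N x, hB N y])
    have e2 : ‖iteratedFDeriv ℝ N g x - iteratedFDeriv ℝ N g y‖ ≤ B (N + 1) * ‖x - y‖ := by
      refine convex_univ.norm_image_sub_le_of_norm_fderiv_le (𝕜 := ℝ)
        (fun u _ => hg.differentiable_iteratedFDeriv (by exact_mod_cast WithTop.coe_lt_top _) u)
        (fun u _ => ?_) (Set.mem_univ y) (Set.mem_univ x)
      rw [norm_fderiv_iteratedFDeriv]
      exact hB (N + 1) u
    have s0 := hB0 N
    have s1 := hB0 (N + 1)
    rcases le_total ‖x - y‖ 1 with h | h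
    · have h2 : ‖x - y‖ ≤ ‖x - y‖ ^ (γ - N) := by
        rcases (norm_nonneg (x - y)).eq_or_lt with h0 | h0
        · rw [← h0]; positivity
        · nth_rewrite 1 [← Real.rpow_one ‖x - y‖]
          exact Real.rpow_le_rpow_of_exponent_ge h0 h (by linarith)
      calc _ ≤ B (N + 1) * ‖x - y‖ := e2
        _ ≤ B (N + 1) * ‖x - y‖ ^ (γ - N) := mul_le_mul_of_nonneg_left h2 s1
        _ ≤ _ := mul_le_mul_of_nonneg_right (by linarith) (by positivity)
    · have h2 : 1 ≤ ‖x - y‖ ^ (γ - N) := Real.one_le_rpow h (by linarith)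
      calc _ ≤ 2 * B N * 1 := by rw [mul_one]; exact e1
        _ ≤ 2 * B N * ‖x - y‖ ^ (γ - N) := mul_le_mul_of_nonneg_left h2 (by linarith)
        _ ≤ _ := mul_le_mul_of_nonneg_right (by linarith) (by positivity)

end Regularity

/-! ### Expansion of Taylor polynomials over forests -/

section Expansion

variable {α : Type} {d : ℕ} {G : Type*} [NormedAddCommGroup G] [NormedSpace ℝ G]

theorem Forest.singleton_injective : Function.Injective fun τ : Tree α => ({τ} : Forest α) :=
  fun _ _ h => Multiset.singleton_inj.1 h

namespace Tree

theorem finite_size_le [Finite α] (N : ℕ) : {τ : Tree α | τ.size ≤ N}.Finite := by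
  refine ((Forest.finite_size_le (α := α) N).preimage
    (f := fun τ : Tree α => ({τ} : Forest α)) Forest.singleton_injective.injOn).subset
    fun τ hτ => ?_
  simpa [Forest.size_singleton] using hτ

/-- The finite set of the trees with at most `N` vertices. -/
noncomputable def upTo (α : Type) [Finite α] (N : ℕ) : Finset (Tree α) :=
  (finite_size_le (α := α) N).toFinset

theorem mem_upTo [Finite α] {N : ℕ} {τ : Tree α} : τ ∈ upTo α N ↔ τ.size ≤ N := by
  simp [upTo]

end Tree

theorem multiDeriv_zero (g : EuclideanSpace ℝ (Fin d) → G) (x : EuclideanSpace ℝ (Fin d)) :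
    multiDeriv g 0 x = g x := by
  unfold multiDeriv
  rw [iteratedFDeriv_eq_get g x (l := []) (by simp) _ fun i => absurd i.2 (by simp)]
  rfl

theorem multiDeriv_id {W : Multiset (EuclideanSpace ℝ (Fin d) → EuclideanSpace ℝ (Fin d))}
    (h : 1 < Multiset.card W) (x : EuclideanSpace ℝ (Fin d)) : multiDeriv id W x = 0 := by
  unfold multiDeriv
  have : ∀ n, 1 < n → iteratedFDeriv ℝ n (id : EuclideanSpace ℝ (Fin d) → _) x = 0 := by
    intro n hn
    obtain ⟨n, rfl⟩ := Nat.exists_eq_add_of_lt hn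
    ext1 v
    rw [show 1 + n + 1 = (n + 1) + 1 by ring] at *
    rw [iteratedFDeriv_succ_apply_right, funext fun y => fderiv_id,
      iteratedFDeriv_const_of_ne (by omega)]
    rfl
  rw [this _ (by simpa using h)]
  rfl

theorem multiDeriv_singleton {g : EuclideanSpace ℝ (Fin d) → G} (hg : ContDiff ℝ 1 g)
    (w : EuclideanSpace ℝ (Fin d) → EuclideanSpace ℝ (Fin d)) (x : EuclideanSpace ℝ (Fin d)) :
    multiDeriv g {w} x = fderiv ℝ g x (w x) := by
  have h := multiDeriv_map_univ (n := 1) (by exact_mod_cast hg) (fun _ => w) x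
  simpa using h

theorem Forest.symm_zero : Forest.symm (0 : Forest α) = 1 := by
  simp [Forest.symm, Forest.multFactorial]

theorem Forest.symm_singleton (τ : Tree α) : Forest.symm {τ} = τ.symm := by
  simp [Forest.symm, Forest.multFactorial]

theorem dualOp_id [Finite α] {N : ℕ}
    (V : α → EuclideanSpace ℝ (Fin d) → EuclideanSpace ℝ (Fin d)) (Y : Dual α)
    (x : EuclideanSpace ℝ (Fin d)) :
    dualOp N V Y id x =
      ∑ τ ∈ Tree.upTo α N, (Y {τ} * (τ.symm : ℝ)⁻¹) • elemField V τ x := by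
  unfold dualOp
  symm
  rw [← Finset.sum_subset (s₁ := (Tree.upTo α N).map ⟨_, Forest.singleton_injective⟩)]
  · rw [Finset.sum_map]
    refine Finset.sum_congr rfl fun τ _ => ?_
    simp [forestOp, Forest.symm_singleton, multiDeriv_singleton contDiff_id, mul_smul]
  · intro φ hφ
    obtain ⟨τ, hτ, rfl⟩ := Finset.mem_map.1 hφ
    exact Forest.mem_upTo.2 ((Forest.size_singleton τ).trans_le (Tree.mem_upTo.1 hτ))
  · intro φ hφ hφ'
    unfold forestOp
    split_ifs with h0
    · exact smul_zero _
    · have h1 : Multiset.card φ ≠ 1 := by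
        intro h1
        obtain ⟨τ, rfl⟩ := Multiset.card_eq_one.1 h1
        refine hφ' (Finset.mem_map.2 ⟨τ, ?_, rfl⟩)
        rw [Tree.mem_upTo, ← Forest.size_singleton]
        exact Forest.mem_upTo.1 hφ
      have h2 := Multiset.card_pos.2 h0
      rw [multiDeriv_id (by rw [Multiset.card_map]; omega), smul_zero, smul_zero]

/-- A multiset `m` of `k` trees comes from `k!/∏ nᵢ!` tuples, and its coefficient carries `∏
σ(τᵢ)^{-nᵢ}`. With the prefactor `1/k!` this is exactly `1/σ(m)`: symmetry factors are made for this
identity. -/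
theorem iteratedFDeriv_sum_smul {g : EuclideanSpace ℝ (Fin d) → G} {k : ℕ} (hg : ContDiff ℝ k g)
    (V : α → EuclideanSpace ℝ (Fin d) → EuclideanSpace ℝ (Fin d)) (S : Finset (Tree α))
    (y : Tree α → ℝ) (x : EuclideanSpace ℝ (Fin d)) :
    (k.factorial : ℝ)⁻¹ • (iteratedFDeriv ℝ k g x fun _ =>
        ∑ τ ∈ S, (y τ * (τ.symm : ℝ)⁻¹) • elemField V τ x) =
      ∑ m ∈ S.sym k, (((m : Forest α).map y).prod * (Forest.symm (m : Forest α) : ℝ)⁻¹) •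
        multiDeriv g ((m : Forest α).map (elemField V)) x := by
  rw [ContinuousMultilinearMap.map_sum_finset]
  let H : Forest α → G := fun m => (m.map fun τ => y τ * (τ.symm : ℝ)⁻¹).prod •
    multiDeriv g (m.map (elemField V)) x
  have e : ∀ q : Fin k → Tree α,
      (iteratedFDeriv ℝ k g x fun i => (y (q i) * ((q i).symm : ℝ)⁻¹) • elemField V (q i) x) =
      H (Finset.univ.val.map q) := by
    intro q
    rw [ContinuousMultilinearMap.map_smul_univ]
    dsimp only [H]
    rw [Multiset.map_map, Multiset.map_map, multiDeriv_map_univ hg]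
    rfl
  rw [Finset.sum_congr rfl fun q _ => e q, sum_piFinset_eq_sum_sym S k H, Finset.smul_sum]
  refine Finset.sum_congr rfl fun m _ => ?_
  dsimp only [H]
  rw [smul_smul, smul_smul]
  congr 1
  have h := prod_count_factorial_mul_countPerms (m : Forest α)
  rw [Sym.card_coe] at h
  have h' : ((Forest.multFactorial (m : Forest α) : ℕ) : ℝ) * ((m : Forest α).countPerms : ℝ) =
      (k.factorial : ℝ) := by
    exact_mod_cast h
  have p1 : ((k.factorial : ℕ) : ℝ) ≠ 0 := by positivity
  have p2 : ((Forest.multFactorial (m : Forest α) : ℕ) : ℝ) ≠ 0 := fun h0 =>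
    p1 (by rw [← h', h0, zero_mul])
  have p3 : ((m : Forest α).countPerms : ℝ) ≠ 0 := fun h0 => p1 (by rw [← h', h0, mul_zero])
  have h3 : ((m : Forest α).map fun τ => y τ * (τ.symm : ℝ)⁻¹).prod =
      ((m : Forest α).map y).prod * ((((m : Forest α).map Tree.symm).prod : ℕ) : ℝ)⁻¹ := by
    rw [Multiset.prod_map_mul, Multiset.prod_map_inv, Nat.cast_multiset_prod, Multiset.map_map]
    rfl
  rw [h3, Forest.symm, Nat.cast_mul, mul_inv, ← h', mul_inv]
  field_simp

/-- A forest with at most `N` vertices has at most `N` trees, each with at most `N` vertices, so it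
occurs once on the left; what remains is of higher order. -/
theorem sum_sym_eq_sum_upTo [Finite α] (N : ℕ) (t : Forest α → ℝ) :
    ∑ k ∈ Finset.range (N + 1), ∑ m ∈ (Tree.upTo α N).sym k, t m =
      ∑ φ ∈ Forest.upTo α N, t φ + ∑ k ∈ Finset.range (N + 1),
        ∑ m ∈ ((Tree.upTo α N).sym k).filter
          fun m : Sym (Tree α) k => N < Forest.size (m : Forest α), t m := by
  rw [← Finset.sum_fiberwise_of_maps_to (g := Multiset.card) (t := Finset.range (N + 1))
    (fun φ hφ => Finset.mem_range.2 (Nat.lt_succ_of_le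
      ((Forest.card_le_size φ).trans (Forest.mem_upTo.1 hφ)))), ← Finset.sum_add_distrib]
  refine Finset.sum_congr rfl fun k _ => ?_
  rw [← Finset.sum_filter_not_add_sum_filter _
    (fun m : Sym (Tree α) k => N < Forest.size (m : Forest α))]
  congr 1
  refine Finset.sum_bij (fun m _ => (m : Forest α)) ?_
    (fun m _ m' _ h => Sym.coe_injective h) ?_ fun _ _ => rfl
  · intro m hm
    rw [Finset.mem_filter] at hm ⊢
    exact ⟨Forest.mem_upTo.2 (not_lt.1 hm.2), m.card_coe⟩
  · intro φ hφ
    rw [Finset.mem_filter, Forest.mem_upTo] at hφ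
    refine ⟨Sym.mk φ hφ.2, ?_, rfl⟩
    rw [Finset.mem_filter, Finset.mem_sym_iff]
    refine ⟨fun τ hτ => Tree.mem_upTo.2 (le_trans ?_ hφ.1), not_lt.2 hφ.1⟩
    exact Multiset.le_sum_of_mem (Multiset.mem_map_of_mem Tree.size hτ)

/-- As `V(𝟏*) = 0`, the value `g x` supplies the missing term of the empty forest; on the others the
character property splits `Y φ` into a product over trees. -/
theorem add_dualOp [Finite α] {N : ℕ}
    (V : α → EuclideanSpace ℝ (Fin d) → EuclideanSpace ℝ (Fin d)) {Y : Dual α}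
    (hY : Dual.IsCharUpTo N Y) (g : EuclideanSpace ℝ (Fin d) → ℝ) (x : EuclideanSpace ℝ (Fin d)) :
    g x + dualOp N V Y g x = ∑ φ ∈ Forest.upTo α N,
      ((φ.map fun τ => Y {τ}).prod * (Forest.symm φ : ℝ)⁻¹) •
        multiDeriv g (φ.map (elemField V)) x := by
  have h0 : (0 : Forest α) ∈ Forest.upTo α N := Forest.mem_upTo.2 (Nat.zero_le _)
  unfold dualOp
  rw [← Finset.add_sum_erase _ _ h0, ← Finset.add_sum_erase (Forest.upTo α N) (fun φ =>
    ((φ.map fun τ => Y {τ}).prod * (Forest.symm φ : ℝ)⁻¹) •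
        multiDeriv g (φ.map (elemField V)) x) h0]
  simp only [forestOp, if_true, smul_zero, zero_add, Multiset.map_zero, Multiset.prod_zero,
    Forest.symm_zero, multiDeriv_zero, Nat.cast_one, inv_one, mul_one, one_smul]
  congr 1
  refine Finset.sum_congr rfl fun φ hφ => ?_
  rw [Finset.mem_erase] at hφ
  rw [if_neg hφ.1, ← hY.apply_eq_prod φ (Forest.mem_upTo.1 hφ.2), mul_smul]

end Expansion

/-- The pairs of times `0 ≤ s < t ≤ T`. -/
def timePairs (T : ℝ) : Set (ℝ × ℝ) := {q | 0 ≤ q.1 ∧ q.1 < q.2 ∧ q.2 ≤ T}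

/-! ### Uniform estimates over pairs of times -/

section TimePairs

variable {T : ℝ} {F : Type*} [NormedAddCommGroup F]

theorem isBigO_timePairs_iff {f : ℝ × ℝ → F} {a : ℝ} :
    f =O[𝓟 (timePairs T)] (fun q => (q.2 - q.1) ^ a) ↔
      ∃ C : ℝ, ∀ s t, 0 ≤ s → s < t → t ≤ T → ‖f (s, t)‖ ≤ C * (t - s) ^ a := by
  rw [isBigO_principal]
  refine exists_congr fun C => ⟨fun h s t h0 hst hT => ?_, fun h q hq => ?_⟩
  · have := h (s, t) ⟨h0, hst, hT⟩
    rwa [Real.norm_of_nonneg (Real.rpow_nonneg (sub_nonneg.2 hst.le) a)] at this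
  · have := h q.1 q.2 hq.1 hq.2.1 hq.2.2
    rwa [Real.norm_of_nonneg (Real.rpow_nonneg (sub_nonneg.2 hq.2.1.le) a)]

theorem isBigO_rpow_of_le {a b : ℝ} (h : a ≤ b) :
    (fun q : ℝ × ℝ => (q.2 - q.1) ^ b) =O[𝓟 (timePairs T)] fun q => (q.2 - q.1) ^ a := by
  refine isBigO_timePairs_iff.2 ⟨T ^ (b - a), fun s t h0 hst hT => ?_⟩
  have hpos : 0 < t - s := sub_pos.2 hst
  rw [Real.norm_of_nonneg (Real.rpow_nonneg hpos.le b)]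
  calc (t - s) ^ b = (t - s) ^ (b - a) * (t - s) ^ a := by
        rw [← Real.rpow_add hpos]; ring_nf
    _ ≤ T ^ (b - a) * (t - s) ^ a := by
        refine mul_le_mul_of_nonneg_right ?_ (Real.rpow_nonneg hpos.le a)
        exact Real.rpow_le_rpow hpos.le (by linarith) (by linarith)

theorem isBigO_rpow_one {b : ℝ} (h : 0 ≤ b) :
    (fun q : ℝ × ℝ => (q.2 - q.1) ^ b) =O[𝓟 (timePairs T)] fun _ => (1 : ℝ) := by
  simpa using isBigO_rpow_of_le (T := T) h

theorem isBigO_comp_of_bounded {d : ℕ} {z : ℝ → EuclideanSpace ℝ (Fin d)} {R : ℝ}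
    (hz : ∀ t, 0 ≤ t → t ≤ T → ‖z t‖ ≤ R) {h : EuclideanSpace ℝ (Fin d) → F}
    (hc : Continuous h) :
    (fun q : ℝ × ℝ => h (z q.1)) =O[𝓟 (timePairs T)] fun _ => (1 : ℝ) := by
  obtain ⟨C, hC⟩ :=
      (isCompact_closedBall (0 : EuclideanSpace ℝ (Fin d)) R).exists_bound_of_continuousOn
    hc.continuousOn
  refine isBigO_principal.2 ⟨C, fun q hq => ?_⟩
  rw [norm_one, mul_one]
  exact hC _ (mem_closedBall_zero_iff.2 (hz _ hq.1 (hq.2.1.le.trans hq.2.2)))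

end TimePairs

/-! ### Size of the rough path increments -/

section RoughPath

variable {ℓ d : ℕ} {p T : ℝ} {X : ℝ → Dual (Fin ℓ)}

theorem IsHolderBranchedRoughPath.isBigO_increment (hX : IsHolderBranchedRoughPath p T X)
    (φ : Forest (Fin ℓ)) (hφ : φ.size ≤ ⌊p⌋₊) :
    (fun q : ℝ × ℝ => Dual.increment ⌊p⌋₊ (X q.1) (X q.2) φ) =O[𝓟 (timePairs T)]
      fun q => (q.2 - q.1) ^ ((φ.size : ℝ) / p) :=
  isBigO_timePairs_iff.2 (hX.bound φ hφ)

theorem IsHolderBranchedRoughPath.isCharUpTo_increment (hX : IsHolderBranchedRoughPath p T X)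
    {q : ℝ × ℝ} (hq : q ∈ timePairs T) :
    Dual.IsCharUpTo ⌊p⌋₊ (Dual.increment ⌊p⌋₊ (X q.1) (X q.2)) :=
  Dual.isCharUpTo_increment (hX.mem_group _ hq.1 (hq.2.1.le.trans hq.2.2))
    (hX.mem_group _ (hq.1.trans hq.2.1.le) hq.2.2)

/-- Only the individual trees are limited to `[p]` vertices: the bound serves for the leftover
monomials, whose total size exceeds `[p]`. -/
theorem IsHolderBranchedRoughPath.isBigO_prod (hX : IsHolderBranchedRoughPath p T X)
    (φ : Forest (Fin ℓ)) (hφ : ∀ τ ∈ φ, τ.size ≤ ⌊p⌋₊) :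
    (fun q : ℝ × ℝ => (φ.map fun τ => Dual.increment ⌊p⌋₊ (X q.1) (X q.2) {τ}).prod)
      =O[𝓟 (timePairs T)] fun q => (q.2 - q.1) ^ ((φ.size : ℝ) / p) := by
  induction φ using Multiset.induction_on with
  | empty => simpa [Forest.size_zero] using isBigO_refl (fun _ : ℝ × ℝ => (1 : ℝ)) (𝓟 (timePairs T))
  | cons τ φ ih =>
    have h1 := hX.isBigO_increment {τ} (by
      rw [Forest.size_singleton]; exact hφ τ (Multiset.mem_cons_self _ _))
    have h2 := ih fun σ hσ => hφ σ (Multiset.mem_cons_of_mem hσ)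
    simp only [Multiset.map_cons, Multiset.prod_cons]
    refine (h1.mul h2).congr' EventuallyEq.rfl ?_
    refine eventually_principal.2 fun q hq => ?_
    dsimp only
    rw [← Real.rpow_add (sub_pos.2 hq.2.1), Forest.size_singleton, Forest.size_cons]
    push_cast
    ring_nf

/-- Every contributing forest has at least one vertex. The filter `l` allows restricting to pairs
with `s = 0`, before `z` is known to be bounded. -/
theorem isBigO_dualOp_of_bounded (hp : 0 < p) (hX : IsHolderBranchedRoughPath p T X)
    {G : Type*} [NormedAddCommGroup G] [NormedSpace ℝ G]
    {V : Fin ℓ → EuclideanSpace ℝ (Fin d) → EuclideanSpace ℝ (Fin d)}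
    {z : ℝ → EuclideanSpace ℝ (Fin d)} {g : EuclideanSpace ℝ (Fin d) → G}
    {l : Filter (ℝ × ℝ)} (hl : l ≤ 𝓟 (timePairs T))
    (h : ∀ φ : Forest (Fin ℓ), φ.size ≤ ⌊p⌋₊ →
      (fun q : ℝ × ℝ => forestOp V φ g (z q.1)) =O[l] fun _ => (1 : ℝ)) :
    (fun q : ℝ × ℝ => dualOp ⌊p⌋₊ V (Dual.increment ⌊p⌋₊ (X q.1) (X q.2)) g (z q.1))
      =O[l] fun q => (q.2 - q.1) ^ (1 / p) := by
  unfold dualOp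
  refine IsBigO.fun_sum fun φ hφ => ?_
  rw [Forest.mem_upTo] at hφ
  by_cases h0 : φ = 0
  · simp only [forestOp, h0, if_true, smul_zero]
    exact isBigO_zero (E' := G) _ _
  · have h1 := Forest.size_pos_of_ne_zero h0
    have h2 : (1 : ℝ) / p ≤ (φ.size : ℝ) / p :=
      div_le_div_of_nonneg_right (by exact_mod_cast h1) hp.le
    simpa using (((hX.isBigO_increment φ hφ).trans (isBigO_rpow_of_le h2)).mono hl).smul (h φ hφ)

end RoughPath

/-! ### From Davie to Bailleul -/

section DavieToBailleul

variable {ℓ d : ℕ} {p T : ℝ} {X : ℝ → Dual (Fin ℓ)}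
  {V : Fin ℓ → EuclideanSpace ℝ (Fin d) → EuclideanSpace ℝ (Fin d)}
  {z : ℝ → EuclideanSpace ℝ (Fin d)}

theorem IsDavieSolution.exists_bound (hp : 0 < p) (hX : IsHolderBranchedRoughPath p T X)
    (hz : IsDavieSolution p T X V z) : ∃ R : ℝ, ∀ t, 0 ≤ t → t ≤ T → ‖z t‖ ≤ R := by
  obtain ⟨a, ha, hC⟩ := hz
  have hD : (fun q : ℝ × ℝ => z q.2 - (z q.1 +
      dualOp ⌊p⌋₊ V (Dual.increment ⌊p⌋₊ (X q.1) (X q.2)) id (z q.1))) =O[𝓟 (timePairs T)]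
        fun q => (q.2 - q.1) ^ a := isBigO_timePairs_iff.2 hC
  -- With `s = 0` all coefficients are evaluated at the single point `z 0`, so the Davie estimate
  -- bounds `z t` directly.
  have hl : 𝓟 (timePairs T ∩ {q | q.1 = 0}) ≤ 𝓟 (timePairs T) :=
    principal_mono.2 Set.inter_subset_left
  have hconst : ∀ {G : Type} [NormedAddCommGroup G] (h : EuclideanSpace ℝ (Fin d) → G),
      (fun q : ℝ × ℝ => h (z q.1)) =O[𝓟 (timePairs T ∩ {q | q.1 = 0})] fun _ => (1 : ℝ) := by
    intro G _ h
    refine isBigO_principal.2 ⟨‖h (z 0)‖, fun q hq => ?_⟩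
    rw [show q.1 = 0 from hq.2, norm_one, mul_one]
  have h1 := (isBigO_dualOp_of_bounded hp hX (V := V) hl fun φ _ => hconst (forestOp V φ id)).trans
    ((isBigO_rpow_one (by positivity)).mono hl)
  have h2 := (hD.mono hl).trans ((isBigO_rpow_one (by linarith)).mono hl)
  have h3 := h2.add ((hconst id).add h1)
  simp only [id, sub_add_cancel] at h3
  obtain ⟨C, hC⟩ := isBigO_principal.1 h3
  refine ⟨max C ‖z 0‖, fun t h0 hT => ?_⟩
  rcases h0.eq_or_lt with rfl | h0
  · exact le_max_right _ _
  · have := hC (0, t) ⟨⟨le_rfl, h0, hT⟩, rfl⟩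
    rw [norm_one, mul_one] at this
    exact this.trans (le_max_left _ _)

theorem IsDavieSolution.isBailleulSolution {γ : ℝ} (hp : 1 < p) (hγ : p < γ)
    (hX : IsHolderBranchedRoughPath p T X) (hV : ∀ i, IsCgamma γ (V i))
    (hz : IsDavieSolution p T X V z) : IsBailleulSolution p T X V (IsCgamma γ) z := by
  have hp0 : 0 < p := by linarith
  obtain ⟨R, hR⟩ := hz.exists_bound hp0 hX
  obtain ⟨a, ha, hC⟩ := hz
  have hD : (fun q : ℝ × ℝ => z q.2 - (z q.1 +
      dualOp ⌊p⌋₊ V (Dual.increment ⌊p⌋₊ (X q.1) (X q.2)) id (z q.1))) =O[𝓟 (timePairs T)]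
        fun q => (q.2 - q.1) ^ a := isBigO_timePairs_iff.2 hC
  obtain ⟨β, hβ0, hβ1, hβ, hreg⟩ := exists_holder_exponent (d := d) (G := ℝ) hp0.le hγ
  obtain ⟨_, -, -, -, hregV⟩ := exists_holder_exponent (d := d)
    (G := EuclideanSpace ℝ (Fin d)) hp0.le hγ
  have hV' := fun i => (hregV (V i) (hV i)).1
  set N := ⌊p⌋₊ with hNdef
  have hN : 1 ≤ N := Nat.one_le_floor_iff p |>.2 hp.le
  have hb1 : 1 < ((N : ℝ) + β) / p := (one_lt_div hp0).2 hβ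
  refine ⟨min a (((N : ℝ) + β) / p), lt_min ha hb1, fun f hf => ?_⟩
  obtain ⟨hfN, hfH⟩ := hreg f hf
  obtain ⟨C, hC0, hfC⟩ := hfH R
  let Y : ℝ × ℝ → Dual (Fin ℓ) := fun q => Dual.increment N (X q.1) (X q.2)
  let δ : ℝ × ℝ → EuclideanSpace ℝ (Fin d) := fun q => z q.2 - z q.1
  let v : ℝ × ℝ → EuclideanSpace ℝ (Fin d) := fun q => dualOp N V (Y q) id (z q.1)
  have hv : v =O[𝓟 (timePairs T)] fun q => (q.2 - q.1) ^ (1 / p) :=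
    isBigO_dualOp_of_bounded hp0 hX le_rfl fun φ hφ =>
      isBigO_comp_of_bounded hR (continuous_forestOp hV' contDiff_id φ hφ)
  have hδv : (fun q => δ q - v q) =O[𝓟 (timePairs T)] fun q => (q.2 - q.1) ^ a :=
    hD.congr_left fun q => by simp only [δ, v, Y]; abel
  have hp1 : 1 / p ≤ a := ((div_lt_one hp0).2 hp).le.trans ha.le
  have hδ : δ =O[𝓟 (timePairs T)] fun q => (q.2 - q.1) ^ (1 / p) :=
    ((hδv.trans (isBigO_rpow_of_le hp1)).add hv).congr_left fun q => sub_add_cancel _ _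
  have hv1 := hv.trans (isBigO_rpow_one (T := T) (by positivity))
  have hδ1 := hδ.trans (isBigO_rpow_one (T := T) (by positivity))
  have taylor : (fun q => f (z q.2) - ∑ k ∈ Finset.range (N + 1),
      (k.factorial : ℝ)⁻¹ * iteratedFDeriv ℝ k f (z q.1) fun _ => δ q) =O[𝓟 (timePairs T)]
        fun q => (q.2 - q.1) ^ (((N : ℝ) + β) / p) := by
    have e1 : (fun q => f (z q.2) - ∑ k ∈ Finset.range (N + 1),
        (k.factorial : ℝ)⁻¹ * iteratedFDeriv ℝ k f (z q.1) fun _ => δ q) =O[𝓟 (timePairs T)]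
          fun q => ‖δ q‖ ^ β * ‖δ q‖ ^ N := by
      refine isBigO_principal.2 ⟨C, fun q hq => ?_⟩
      have hs := hR q.1 hq.1 (hq.2.1.le.trans hq.2.2)
      have ht := hR q.2 (hq.1.trans hq.2.1.le) hq.2.2
      have key : ∀ u ∈ Set.Icc (0 : ℝ) 1,
          ‖iteratedFDeriv ℝ N f (z q.1 + u • δ q) - iteratedFDeriv ℝ N f (z q.1)‖ ≤
            C * ‖δ q‖ ^ β := by
        intro u hu
        have hm : ‖z q.1 + u • δ q‖ ≤ R := by
          rw [← mem_closedBall_zero_iff] at hs ht ⊢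
          exact (convex_closedBall _ R).add_smul_sub_mem hs ht hu
        refine (hfC _ _ hm hs).trans (mul_le_mul_of_nonneg_left ?_ hC0)
        refine Real.rpow_le_rpow (norm_nonneg _) ?_ hβ0.le
        rw [add_sub_cancel_left, norm_smul, Real.norm_of_nonneg hu.1]
        exact mul_le_of_le_one_left (norm_nonneg _) hu.2
      obtain ⟨n, hn⟩ : ∃ n, N = n + 1 := ⟨N - 1, by omega⟩
      have h := abs_sub_taylor_le (n := n) (hn ▸ hfN) (z q.1) (δ q) (hn ▸ key)
      rw [← hn, show z q.1 + δ q = z q.2 from add_sub_cancel _ _] at h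
      rw [Real.norm_eq_abs, Real.norm_of_nonneg (by positivity), ← mul_assoc]
      exact h
    refine e1.trans (((hδ.norm_left.rpow hβ0.le ?_).mul (hδ.norm_left.pow N)).trans_eventuallyEq ?_)
    · exact eventually_principal.2 fun q hq => Real.rpow_nonneg (sub_pos.2 hq.2.1).le _
    · refine eventually_principal.2 fun q hq => ?_
      have hpos := sub_pos.2 hq.2.1
      dsimp only
      rw [← Real.rpow_natCast, ← Real.rpow_mul hpos.le, ← Real.rpow_mul hpos.le,
        ← Real.rpow_add hpos]
      congr 1
      ring
  -- A multilinear map is Lipschitz on bounded sets, so exchanging `δ` for `v` costs a multiple of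
  -- `‖δ - v‖`, the Davie error.
  have diff : ∀ k ∈ Finset.range (N + 1), (fun q => (k.factorial : ℝ)⁻¹ *
      ((iteratedFDeriv ℝ k f (z q.1) fun _ => δ q) - iteratedFDeriv ℝ k f (z q.1) fun _ => v q))
        =O[𝓟 (timePairs T)] fun q => (q.2 - q.1) ^ a := by
    intro k hk
    have hk' : k ≤ N := Nat.lt_succ_iff.1 (Finset.mem_range.1 hk)
    refine IsBigO.const_mul_left ?_ _
    have e1 : (fun q => (iteratedFDeriv ℝ k f (z q.1) fun _ => δ q) -
        iteratedFDeriv ℝ k f (z q.1) fun _ => v q) =O[𝓟 (timePairs T)]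
          fun q => ‖iteratedFDeriv ℝ k f (z q.1)‖ * k * (‖δ q‖ + ‖v q‖) ^ (k - 1) *
            ‖δ q - v q‖ := by
      refine isBigO_of_le _ fun q => ?_
      refine ((iteratedFDeriv ℝ k f (z q.1)).norm_image_sub_le _ _).trans ?_
      rw [Real.norm_of_nonneg (by positivity), Fintype.card_fin]
      have n1 : ‖fun _ : Fin k => δ q‖ ≤ ‖δ q‖ := pi_norm_const_le _
      have n2 : ‖fun _ : Fin k => v q‖ ≤ ‖v q‖ := pi_norm_const_le _
      have n3 : ‖(fun _ : Fin k => δ q) - fun _ : Fin k => v q‖ ≤ ‖δ q - v q‖ :=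
        pi_norm_const_le (δ q - v q)
      have n4 : max ‖fun _ : Fin k => δ q‖ ‖fun _ : Fin k => v q‖ ≤ ‖δ q‖ + ‖v q‖ :=
        max_le (by linarith [norm_nonneg (v q)]) (by linarith [norm_nonneg (δ q)])
      gcongr
    refine e1.trans ?_
    have h1 : (fun q : ℝ × ℝ => iteratedFDeriv ℝ k f (z q.1)) =O[𝓟 (timePairs T)]
        fun _ => (1 : ℝ) :=
      isBigO_comp_of_bounded hR (hfN.continuous_iteratedFDeriv (by exact_mod_cast hk'))
    have h2 := (h1.norm_left.mul (isBigO_const_const (k : ℝ) (one_ne_zero (α := ℝ)) _)).mul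
      ((hδ1.norm_left.add hv1.norm_left).pow (k - 1))
    simpa using h2.mul hδv.norm_left
  let t : Forest (Fin ℓ) → ℝ × ℝ → ℝ := fun φ q =>
    ((φ.map fun τ => Y q {τ}).prod * (Forest.symm φ : ℝ)⁻¹) •
      multiDeriv f (φ.map (elemField V)) (z q.1)
  have rest : ∀ k ∈ Finset.range (N + 1), (fun q => ∑ m ∈ ((Tree.upTo (Fin ℓ) N).sym k).filter
      fun m : Sym (Tree (Fin ℓ)) k => N < Forest.size (m : Forest (Fin ℓ)), t m q)
        =O[𝓟 (timePairs T)] fun q => (q.2 - q.1) ^ (((N : ℝ) + β) / p) := by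
    intro k hk
    have hk' : k ≤ N := Nat.lt_succ_iff.1 (Finset.mem_range.1 hk)
    refine IsBigO.fun_sum fun m hm => ?_
    rw [Finset.mem_filter, Finset.mem_sym_iff] at hm
    have hτ : ∀ τ ∈ (m : Forest (Fin ℓ)), τ.size ≤ N := fun τ hτ => Tree.mem_upTo.1 (hm.1 τ hτ)
    have h1 := hX.isBigO_prod (m : Forest (Fin ℓ)) hτ
    have h2 : (fun q : ℝ × ℝ => multiDeriv f ((m : Forest (Fin ℓ)).map (elemField V)) (z q.1))
        =O[𝓟 (timePairs T)] fun _ => (1 : ℝ) := by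
      refine isBigO_comp_of_bounded hR (continuous_multiDeriv hfN (by simpa using hk') ?_)
      intro w hw
      obtain ⟨τ, hτm, rfl⟩ := Multiset.mem_map.1 hw
      exact continuous_elemField hV' τ ((hτ τ hτm).trans (Nat.le_succ N))
    -- The leftover forests have at least `N + 1 ≥ N + β` vertices, since `β ≤ 1`.
    have h3 : ((N : ℝ) + β) / p ≤ (Forest.size (m : Forest (Fin ℓ)) : ℝ) / p := by
      refine div_le_div_of_nonneg_right ?_ hp0.le
      have : ((N + 1 : ℕ) : ℝ) ≤ (Forest.size (m : Forest (Fin ℓ)) : ℝ) := by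
        exact_mod_cast hm.2
      push_cast at this
      linarith
    have h4 := ((h1.trans (isBigO_rpow_of_le h3)).mul
      (isBigO_const_const (Forest.symm (m : Forest (Fin ℓ)) : ℝ)⁻¹ (one_ne_zero (α := ℝ)) _)).smul
        h2
    exact h4.congr (fun q => rfl) fun q => by simp
  have expand : ∀ q ∈ timePairs T, f (z q.2) - (f (z q.1) + dualOp N V (Y q) f (z q.1)) =
      (f (z q.2) - ∑ k ∈ Finset.range (N + 1),
        (k.factorial : ℝ)⁻¹ * iteratedFDeriv ℝ k f (z q.1) fun _ => δ q) +
      ∑ k ∈ Finset.range (N + 1), (k.factorial : ℝ)⁻¹ *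
        ((iteratedFDeriv ℝ k f (z q.1) fun _ => δ q) - iteratedFDeriv ℝ k f (z q.1) fun _ => v q) +
      ∑ k ∈ Finset.range (N + 1), ∑ m ∈ ((Tree.upTo (Fin ℓ) N).sym k).filter
        fun m : Sym (Tree (Fin ℓ)) k => N < Forest.size (m : Forest (Fin ℓ)), t m q := by
    intro q hq
    have e1 : ∑ k ∈ Finset.range (N + 1), (k.factorial : ℝ)⁻¹ *
        (iteratedFDeriv ℝ k f (z q.1) fun _ => v q) = ∑ k ∈ Finset.range (N + 1),
          ∑ m ∈ (Tree.upTo (Fin ℓ) N).sym k, t m q := by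
      refine Finset.sum_congr rfl fun k hk => ?_
      have hk' : k ≤ N := Nat.lt_succ_iff.1 (Finset.mem_range.1 hk)
      have := iteratedFDeriv_sum_smul (hfN.of_le (by exact_mod_cast hk')) V
        (Tree.upTo (Fin ℓ) N) (fun τ => Y q {τ}) (z q.1)
      simp only [v, dualOp_id]
      exact this
    rw [sum_sym_eq_sum_upTo N fun φ => t φ q,
      ← add_dualOp V (hX.isCharUpTo_increment hq) f (z q.1)] at e1
    simp only [mul_sub, Finset.sum_sub_distrib]
    rw [e1]
    ring
  have final := ((taylor.trans (isBigO_rpow_of_le (min_le_right a _))).add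
    (IsBigO.fun_sum fun k hk => (diff k hk).trans (isBigO_rpow_of_le (min_le_left a _)))).add
    (IsBigO.fun_sum fun k hk => (rest k hk).trans (isBigO_rpow_of_le (min_le_right a _)))
  exact isBigO_timePairs_iff.1 (final.congr' (eventually_principal.2 fun q hq => (expand q hq).symm)
    EventuallyEq.rfl)

end DavieToBailleul

/-! ### Locality and linearity of the operators -/

section Operators

variable {α : Type} {d : ℕ} {G : Type*} [NormedAddCommGroup G] [NormedSpace ℝ G]
  {G' : Type*} [NormedAddCommGroup G'] [NormedSpace ℝ G']
  (V : α → EuclideanSpace ℝ (Fin d) → EuclideanSpace ℝ (Fin d))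

theorem forestOp_congr {g h : EuclideanSpace ℝ (Fin d) → G} {x : EuclideanSpace ℝ (Fin d)}
    (hgh : g =ᶠ[𝓝 x] h) (φ : Forest α) : forestOp V φ g x = forestOp V φ h x := by
  unfold forestOp multiDeriv
  rw [(hgh.iteratedFDeriv ℝ _).eq_of_nhds]

theorem forestOp_clm_comp (L : G →L[ℝ] G') {g : EuclideanSpace ℝ (Fin d) → G}
    (hg : ContDiff ℝ (⊤ : ℕ∞) g) (x : EuclideanSpace ℝ (Fin d)) (φ : Forest α) :
    forestOp V φ (L ∘ g) x = L (forestOp V φ g x) := by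
  unfold forestOp multiDeriv
  split_ifs
  · simp
  · rw [L.iteratedFDeriv_comp_left (n := (⊤ : ℕ∞)) hg.contDiffAt (by exact_mod_cast le_top),
      map_smul]
    rfl

theorem dualOp_eq_clm_of_eventuallyEq [Finite α] (N : ℕ) (Y : Dual α) (L : G →L[ℝ] G')
    {g : EuclideanSpace ℝ (Fin d) → G} (hg : ContDiff ℝ (⊤ : ℕ∞) g)
    {h : EuclideanSpace ℝ (Fin d) → G'} {x : EuclideanSpace ℝ (Fin d)} (hh : h =ᶠ[𝓝 x] L ∘ g) :
    dualOp N V Y h x = L (dualOp N V Y g x) := by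
  unfold dualOp
  rw [map_sum]
  refine Finset.sum_congr rfl fun φ _ => ?_
  rw [forestOp_congr V hh, forestOp_clm_comp V L hg, map_smul]

variable {V}

theorem exists_bound_forestOp {k : ℕ} (hV : ∀ i, ContDiff ℝ k (V i))
    {g : EuclideanSpace ℝ (Fin d) → G} (hg : ContDiff ℝ k g) (hc : HasCompactSupport g)
    (φ : Forest α) (h : φ.size ≤ k) : ∃ C, ∀ x, ‖forestOp V φ g x‖ ≤ C := by
  refine HasCompactSupport.exists_bound_of_continuous ?_ (continuous_forestOp hV hg φ h)
  refine HasCompactSupport.intro hc fun x hx => ?_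
  have h1 : ∀ n, iteratedFDeriv ℝ n g x = 0 := fun n =>
    Function.notMem_support.1 fun h' => hx (support_iteratedFDeriv_subset (𝕜 := ℝ) n h')
  unfold forestOp multiDeriv
  rw [h1]
  simp

end Operators

/-! ### From Bailleul to Davie -/

section BailleulToDavie

variable {ℓ d : ℕ} {p γ T : ℝ} {X : ℝ → Dual (Fin ℓ)}
  {V : Fin ℓ → EuclideanSpace ℝ (Fin d) → EuclideanSpace ℝ (Fin d)}
  {z : ℝ → EuclideanSpace ℝ (Fin d)}

theorem IsBailleulSolution.mono {𝓒 𝓒' : (EuclideanSpace ℝ (Fin d) → ℝ) → Prop}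
    (h : ∀ f, 𝓒 f → 𝓒' f) (hz : IsBailleulSolution p T X V 𝓒' z) :
    IsBailleulSolution p T X V 𝓒 z := by
  obtain ⟨a, ha, hC⟩ := hz
  exact ⟨a, ha, fun f hf => hC f (h f hf)⟩

/-- Compact support of `g` makes each `V(φ*) g` bounded on the whole space, so no prior bound on `z`
is needed. -/
theorem IsBailleulSolution.isBigO_sub (hp : 1 < p) (hγ : p < γ)
    (hX : IsHolderBranchedRoughPath p T X) (hV : ∀ i, IsCgamma γ (V i))
    (hz : IsBailleulSolution p T X V (IsCgammaBounded γ) z) {g : EuclideanSpace ℝ (Fin d) → ℝ}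
    (hg : ContDiff ℝ (⊤ : ℕ∞) g) (hc : HasCompactSupport g) :
    (fun q : ℝ × ℝ => g (z q.2) - g (z q.1)) =O[𝓟 (timePairs T)]
      fun q => (q.2 - q.1) ^ (1 / p) := by
  have hp0 : 0 < p := by linarith
  obtain ⟨a, ha, hC⟩ := hz
  have h1 : (fun q : ℝ × ℝ => g (z q.2) - (g (z q.1) +
      dualOp ⌊p⌋₊ V (Dual.increment ⌊p⌋₊ (X q.1) (X q.2)) g (z q.1))) =O[𝓟 (timePairs T)]
        fun q => (q.2 - q.1) ^ a :=
    isBigO_timePairs_iff.2 (hC g (isCgammaBounded_of_hasCompactSupport (by linarith) hg hc))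
  have hV' : ∀ i, ContDiff ℝ (⌊p⌋₊ : ℕ) (V i) := fun i =>
    (hV i).1.of_le (by exact_mod_cast Nat.floor_mono hγ.le)
  have h2 := isBigO_dualOp_of_bounded hp0 hX (V := V) (z := z) (g := g) le_rfl fun φ hφ => by
    obtain ⟨C, hC⟩ := exists_bound_forestOp hV' (hg.of_le (by exact_mod_cast le_top)) hc φ hφ
    exact isBigO_principal.2 ⟨C, fun q _ => by simpa using hC (z q.1)⟩
  have hp1 : 1 / p ≤ a := ((div_lt_one hp0).2 hp).le.trans ha.le
  exact ((h1.trans (isBigO_rpow_of_le hp1)).add h2).congr_left fun q => by ring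

theorem IsBailleulSolution.continuousOn (hp : 1 < p) (hγ : p < γ)
    (hX : IsHolderBranchedRoughPath p T X) (hV : ∀ i, IsCgamma γ (V i))
    (hz : IsBailleulSolution p T X V (IsCgammaBounded γ) z) : ContinuousOn z (Set.Icc 0 T) := by
  have hp0 : 0 < p := by linarith
  intro t ht
  refine Metric.tendsto_nhds.2 fun ε hε => ?_
  let χ : ContDiffBump (z t) := ⟨ε / 2, ε, half_pos hε, half_lt_self hε⟩
  obtain ⟨C, hC⟩ := isBigO_timePairs_iff.1
    (hz.isBigO_sub hp hγ hX hV (g := χ) χ.contDiff χ.hasCompactSupport)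
  have hlim : Tendsto (fun s : ℝ => C * |s - t| ^ (1 / p)) (𝓝 t) (𝓝 0) := by
    have hcont : Continuous fun s : ℝ => C * |s - t| ^ (1 / p) :=
      continuous_const.mul ((continuous_abs.comp (continuous_id.sub continuous_const)).rpow_const
        fun _ => Or.inr (by positivity))
    have := hcont.tendsto t
    simpa [Real.zero_rpow (inv_ne_zero hp0.ne')] using this
  have hev : ∀ᶠ s in 𝓝[Set.Icc 0 T] t, C * |s - t| ^ (1 / p) < 1 :=
    (hlim.mono_left nhdsWithin_le_nhds).eventually_lt_const one_pos
  filter_upwards [hev, self_mem_nhdsWithin] with s hs hsT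
  -- As `χ (z t) = 1`, this forces `χ (z s) > 0`, and the support of `χ` is the ball of radius `ε`
  -- around `z t`.
  have hdiff : |χ (z s) - χ (z t)| < 1 := by
    rcases lt_trichotomy s t with h | h | h
    · have := hC s t hsT.1 h ht.2
      rw [abs_sub_comm]
      rw [abs_sub_comm, abs_of_pos (sub_pos.2 h)] at hs
      exact this.trans_lt hs
    · simp [h]
    · have := hC t s ht.1 h hsT.2
      rw [abs_of_pos (sub_pos.2 h)] at hs
      exact this.trans_lt hs
  rw [χ.one_of_mem_closedBall (Metric.mem_closedBall_self (half_pos hε).le), abs_lt] at hdiff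
  have hsupp : z s ∈ Function.support χ := by
    rw [Function.mem_support]
    linarith [hdiff.1]
  rw [χ.support_eq] at hsupp
  exact hsupp

theorem IsBailleulSolution.isDavieSolution (hp : 1 < p) (hγ : p < γ)
    (hX : IsHolderBranchedRoughPath p T X) (hV : ∀ i, IsCgamma γ (V i))
    (hz : IsBailleulSolution p T X V (IsCgammaBounded γ) z) : IsDavieSolution p T X V z := by
  obtain ⟨R, hR⟩ := isCompact_Icc.exists_bound_of_continuousOn (hz.continuousOn hp hγ hX hV)
  obtain ⟨a, ha, hC⟩ := hz
  refine ⟨a, ha, ?_⟩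
  -- The inner radius exceeds `R` so that the cut-off coordinates agree with the true ones on a
  -- neighbourhood of each `z s`, hence with all their derivatives.
  let χ : ContDiffBump (0 : EuclideanSpace ℝ (Fin d)) :=
    ⟨|R| + 1, |R| + 2, by positivity, by linarith⟩
  let L : Fin d → EuclideanSpace ℝ (Fin d) →L[ℝ] ℝ := fun i => EuclideanSpace.proj i
  have key : ∀ i, (fun q : ℝ × ℝ => L i (z q.2 - (z q.1 +
      dualOp ⌊p⌋₊ V (Dual.increment ⌊p⌋₊ (X q.1) (X q.2)) id (z q.1)))) =O[𝓟 (timePairs T)]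
        fun q => (q.2 - q.1) ^ a := by
    intro i
    let g : EuclideanSpace ℝ (Fin d) → ℝ := fun x => χ x * L i x
    have hg : ContDiff ℝ (⊤ : ℕ∞) g := χ.contDiff.mul (L i).contDiff
    have hgL : ∀ x, ‖x‖ ≤ R → g =ᶠ[𝓝 x] L i ∘ id := by
      intro x hx
      have hx' : x ∈ Metric.ball (0 : EuclideanSpace ℝ (Fin d)) (|R| + 1) :=
        mem_ball_zero_iff.2 (by linarith [le_abs_self R])
      filter_upwards [Metric.isOpen_ball.mem_nhds hx'] with y hy
      simp [g, χ.one_of_mem_closedBall (Metric.ball_subset_closedBall hy)]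
    have h1 : (fun q : ℝ × ℝ => g (z q.2) - (g (z q.1) +
        dualOp ⌊p⌋₊ V (Dual.increment ⌊p⌋₊ (X q.1) (X q.2)) g (z q.1))) =O[𝓟 (timePairs T)]
          fun q => (q.2 - q.1) ^ a :=
      isBigO_timePairs_iff.2 (hC g (isCgammaBounded_of_hasCompactSupport (by linarith) hg
        χ.hasCompactSupport.mul_right))
    refine h1.congr' (eventually_principal.2 fun q hq => ?_) EventuallyEq.rfl
    have hs := hgL _ (hR q.1 ⟨hq.1, hq.2.1.le.trans hq.2.2⟩)
    have ht := hgL _ (hR q.2 ⟨hq.1.trans hq.2.1.le, hq.2.2⟩)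
    dsimp only
    rw [hs.eq_of_nhds, ht.eq_of_nhds, dualOp_eq_clm_of_eventuallyEq V _ _ (L i) contDiff_id hs]
    simp
  have hD : (fun q : ℝ × ℝ => z q.2 - (z q.1 +
      dualOp ⌊p⌋₊ V (Dual.increment ⌊p⌋₊ (X q.1) (X q.2)) id (z q.1))) =O[𝓟 (timePairs T)]
        fun q => (q.2 - q.1) ^ a :=
    ((EuclideanSpace.equiv (Fin d) ℝ).isBigO_comp_rev _ _).trans (isBigO_pi.2 key)
  exact isBigO_timePairs_iff.1 hD

end BailleulToDavie

end BranchedRP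

theorem theorem2 {ℓ d : ℕ} {p γ T : ℝ} (hp : 2 < p) (hγ : p < γ) (hT : 0 < T)
    (X : ℝ → BranchedRP.Dual (Fin ℓ)) (hX : BranchedRP.IsHolderBranchedRoughPath p T X)
    (V : Fin ℓ → EuclideanSpace ℝ (Fin d) → EuclideanSpace ℝ (Fin d))
    (hV : ∀ i, BranchedRP.IsCgamma γ (V i))
    (z : ℝ → EuclideanSpace ℝ (Fin d)) :
    (BranchedRP.IsDavieSolution p T X V z ↔
      BranchedRP.IsBailleulSolution p T X V (BranchedRP.IsCgamma γ) z) ∧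
    (BranchedRP.IsDavieSolution p T X V z ↔
      BranchedRP.IsBailleulSolution p T X V (BranchedRP.IsCgammaBounded γ) z) := by
  have hp1 : 1 < p := by linarith
  have h1 : BranchedRP.IsDavieSolution p T X V z →
      BranchedRP.IsBailleulSolution p T X V (BranchedRP.IsCgamma γ) z :=
    fun h => h.isBailleulSolution hp1 hγ hX hV
  have h2 : BranchedRP.IsBailleulSolution p T X V (BranchedRP.IsCgamma γ) z →
      BranchedRP.IsBailleulSolution p T X V (BranchedRP.IsCgammaBounded γ) z :=
    fun h => h.mono fun _ hf => hf.isCgamma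
  have h3 : BranchedRP.IsBailleulSolution p T X V (BranchedRP.IsCgammaBounded γ) z →
      BranchedRP.IsDavieSolution p T X V z := fun h => h.isDavieSolution hp1 hγ hX hV
  exact ⟨⟨h1, h3 ∘ h2⟩, ⟨h2 ∘ h1, h3⟩⟩
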